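/- Let $\Omega\subset\mathbb R^d$ be open (for instance a bounded Lipschitz domain), let $0<\alpha<1$, $\sigma=1-\alpha/2$, $T>0$, $r>0$, and let $\eta\approx 0.475329$ be the positive root of $1-3\rho^2(1+\rho)=0$. Consider the subdiffusion problem $$\partial_t^\alpha u=\Delta u+f\ \text{ in }(0,T]\times\Omega,\qquad u=0\ \text{ on }(0,T]\times\partial\Omega,\qquad u(0)=u^0,$$ in weak form on $H^1_0(\Omega)$, where $\partial_t^\alpha u(t)=\frac1{\Gamma(1-\alpha)}\int_0^t (t-s)^{-\alpha}u'(s)\,ds$, $u^0\in H^1_0(\Omega)$ is attained continuously in $H_0^1(\Omega)$ as $t\to0^+$, and $f(t)\in H^{-1}(\Omega)$ (for instance $f(t)\in L^2(\Omega)$). For $K\ge1$ let $t_j=(j/K)^rT$ $(0\le j\le K)$, $\tau_j=t_j-t_{j-1}$, $\rho_k=\tau_k/\tau_{k-1}$, $t_k^*=t_{k-1}+\sigma\tau_k$. The L2-$1_\sigma$ scheme seeks $u^1,\dots,u^K\in H^1_0(\Omega)$ with (in weak form) $$L_k^{\alpha,*}u=(1-\tfrac\alpha2)\Delta u^k+\tfrac\alpha2\Delta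 u^{k-1}+f(t_k^*),\qquad 1\le k\le K,$$ where $$L_k^{\alpha,*}u=\frac1{\Gamma(1-\alpha)}\sum_{j=1}^{k-1}\bigl(a_j^ku^{j-1}+b_j^ku^j+c_j^ku^{j+1}\bigr)+\frac{\sigma^{1-\alpha}(u^k-u^{k-1})}{\Gamma(2-\alpha)\tau_k^\alpha},$$ $$a_j^k=\int_{t_{j-1}}^{t_j}\frac{2s-t_j-t_{j+1}}{\tau_j(\tau_j+\tau_{j+1})}\frac{ds}{(t_k^*-s)^\alpha},\quad b_j^k=-\int_{t_{j-1}}^{t_j}\frac{2s-t_{j-1}-t_{j+1}}{\tau_j\tau_{j+1}}\frac{ds}{(t_k^*-s)^\alpha},\quad c_j^k=\int_{t_{j-1}}^{t_j}\frac{2s-t_{j-1}-t_j}{\tau_{j+1}(\tau_j+\tau_{j+1})}\frac{ds}{(t_k^*-s)^\alpha}.$$ For all constants $C_1,C_2,C_3$ there is a constant $\tilde C$, depending only on $C_1,C_2,C_3$, $\alpha$, $\Omega$, $T$ and $r$, such that the following holds. Let $u\in C^3((0,T];H^1_0(\Omega))$ be a solution of the problem (for some data $f$, $u^0$) with $\|\partial_t^m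 u(t)\|_{H^1(\Omega)}\le C_m(1+t^{\alpha-m})$ for $m=1,2,3$ and $0<t\le T$. Let $K\ge 1$, and suppose that $r\ge1$ or, more generally, that $\rho_k\ge\eta$ for $2\le k\le K$. Then every solution $u^1,\dots,u^K$ of the scheme satisfies $$\max_{1\le k\le K}\|u(t_k)-u^k\|_{L^2(\Omega)}\le \tilde C\,K^{-\min\{r\alpha,2\}}.$$ -/

import Mathlib

open MeasureTheory Filter Topology
open scoped ContDiff

namespace Subdiffusion

section Sobolev

/-- The space `ℝ^d` with its Euclidean norm. -/
abbrev Space (d : ℕ) : Type := EuclideanSpace ℝ (Fin d)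

/-- The Lebesgue space `L²(Ω; F)`. -/
abbrev L2 {d : ℕ} (Ω : Set (Space d)) (F : Type) [NormedAddCommGroup F] : Type :=
  Lp F 2 (volume.restrict Ω)

/-- The Hilbert space `L²(Ω) × L²(Ω; ℝ^d)`, with norm `(‖v‖² + ‖g‖²)^(1/2)`; a function `v` of
class `H¹` is represented in it by the pair `(v, ∇v)`, whose norm is the `H¹` norm of `v`. -/
abbrev L2Pair {d : ℕ} (Ω : Set (Space d)) : Type :=
  WithLp 2 (L2 Ω ℝ × L2 Ω (Space d))

/-- Smooth functions with compact support in `Ω`. -/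
def IsTest {d : ℕ} (Ω : Set (Space d)) (φ : Space d → ℝ) : Prop :=
  ContDiff ℝ ∞ φ ∧ HasCompactSupport φ ∧ tsupport φ ⊆ Ω

/-- The pairs `(φ, ∇φ)` where `φ` is smooth with compact support in `Ω`. -/
def testPairs {d : ℕ} (Ω : Set (Space d)) : Submodule ℝ (L2Pair Ω) where
  carrier := {p | ∃ φ : Space d → ℝ, IsTest Ω φ ∧
    (p.fst : Space d → ℝ) =ᵐ[volume.restrict Ω] φ ∧
    (p.snd : Space d → Space d) =ᵐ[volume.restrict Ω] gradient φ}
  zero_mem' := by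
    refine ⟨0, ⟨contDiff_const, HasCompactSupport.zero, by simp [tsupport]⟩, ?_, ?_⟩
    · exact Lp.coeFn_zero _ _ _
    · have h : gradient (0 : Space d → ℝ) = 0 := by
        funext x
        simp [gradient]
      rw [h]
      exact Lp.coeFn_zero _ _ _
  add_mem' := by
    rintro p q ⟨φ, ⟨hφ, hφc, hφs⟩, hp1, hp2⟩ ⟨ψ, ⟨hψ, hψc, hψs⟩, hq1, hq2⟩
    refine ⟨φ + ψ, ⟨hφ.add hψ, hφc.add hψc,
      (tsupport_add φ ψ).trans (Set.union_subset hφs hψs)⟩, ?_, ?_⟩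
    · exact (Lp.coeFn_add p.fst q.fst).trans (hp1.add hq1)
    · have h : gradient (φ + ψ) = gradient φ + gradient ψ := by
        funext x
        have h1 := (hφ.differentiable (by simp)) x
        have h2 := (hψ.differentiable (by simp)) x
        simp [gradient, fderiv_add h1 h2]
      rw [h]
      exact (Lp.coeFn_add p.snd q.snd).trans (hp2.add hq2)
  smul_mem' := by
    rintro c p ⟨φ, ⟨hφ, hφc, hφs⟩, hp1, hp2⟩
    refine ⟨c • φ, ⟨hφ.const_smul c, hφc.smul_left (f := fun _ => c),
      (closure_mono (Function.support_const_smul_subset c φ)).trans hφs⟩, ?_, ?_⟩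
    · exact (Lp.coeFn_smul c p.fst).trans (hp1.const_smul c)
    · have h : gradient (c • φ) = c • gradient φ := by
        funext x
        have h1 := (hφ.differentiable (by simp)) x
        simp [gradient, fderiv_const_smul h1]
      rw [h]
      exact (Lp.coeFn_smul c p.snd).trans (hp2.const_smul c)

/-- The Sobolev space `H¹₀(Ω)`: the closure of the smooth functions with compact support in `Ω`
for the `H¹` norm. Its elements are recorded as pairs `(v, ∇v)`, and it carries the `H¹` inner
product and norm. -/
noncomputable def H01 {d : ℕ} (Ω : Set (Space d)) : Submodule ℝ (L2Pair Ω) :=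
  (testPairs Ω).topologicalClosure

instance instCompleteSpaceH01 {d : ℕ} (Ω : Set (Space d)) : CompleteSpace (H01 Ω) :=
  (Submodule.isClosed_topologicalClosure (testPairs Ω)).completeSpace_coe

/-- The function `v ∈ L²(Ω)` underlying an element of `H¹₀(Ω)`. -/
noncomputable def fn {d : ℕ} {Ω : Set (Space d)} (v : H01 Ω) : L2 Ω ℝ := (v : L2Pair Ω).fst

/-- The (weak) gradient `∇v ∈ L²(Ω; ℝ^d)` of an element of `H¹₀(Ω)`. -/
noncomputable def weakGrad {d : ℕ} {Ω : Set (Space d)} (v : H01 Ω) : L2 Ω (Space d) := (v : L2Pair Ω).snd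

end Sobolev

section Continuous

/-- The Caputo derivative
`∂_t^α u (t) = 1 / Γ(1 - α) * ∫_0^t u'(s) (t - s)^(-α) ds` of a vector-valued function. -/
noncomputable def caputo {E : Type*} [NormedAddCommGroup E] [NormedSpace ℝ E]
    (α : ℝ) (u : ℝ → E) (t : ℝ) : E :=
  (Real.Gamma (1 - α))⁻¹ • ∫ s in (0 : ℝ)..t, (t - s) ^ (-α) • deriv u s

/-- `u` solves `∂_t^α u = Δu + f` on `(0, T] × Ω` with `u = 0` on the boundary and initial value
`u⁰`. The boundary condition is membership in `H¹₀(Ω)`, and `Δ` is the weak Laplacian from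
`H¹₀(Ω)` to its dual `H⁻¹(Ω)`, in which `f t` lives (for `f t ∈ L²(Ω)` it is the functional
`v ↦ ∫_Ω f(t, x) v(x) dx`). -/
def IsSolution {d : ℕ} {Ω : Set (Space d)} (α T : ℝ) (f : ℝ → H01 Ω →L[ℝ] ℝ) (u₀ : H01 Ω)
    (u : ℝ → H01 Ω) : Prop :=
  u 0 = u₀ ∧ Tendsto u (𝓝[>] 0) (𝓝 u₀) ∧
    ∀ t ∈ Set.Ioc 0 T, ∀ v : H01 Ω,
      inner ℝ (fn (caputo α u t)) (fn v) = -inner ℝ (weakGrad (u t)) (weakGrad v) + f t v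

end Continuous

section Discrete

/-- The time step `τ_j = t_j - t_{j-1}`, for `j ≥ 1`. -/
def step (t : ℕ → ℝ) (j : ℕ) : ℝ := t j - t (j - 1)

/-- The step ratio `ρ_k = τ_k / τ_{k-1}`, for `k ≥ 2`. -/
noncomputable def ratio (t : ℕ → ℝ) (k : ℕ) : ℝ := step t k / step t (k - 1)

/-- The shifted node `t_k^* = t_{k-1} + σ τ_k` with `σ = 1 - α/2`, for `k ≥ 1`. -/
noncomputable def node (α : ℝ) (t : ℕ → ℝ) (k : ℕ) : ℝ := t (k - 1) + (1 - α / 2) * step t k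

/-- The coefficient `a_j^k`: the integral over `(t_{j-1}, t_j)` of the derivative of the quadratic
Lagrange basis function of the node `t_{j-1}` among `t_{j-1}, t_j, t_{j+1}`, against
`(t_k^* - s)^(-α)`. -/
noncomputable def coeffA (α : ℝ) (t : ℕ → ℝ) (k j : ℕ) : ℝ :=
  ∫ s in t (j - 1)..t j, (2 * s - t j - t (j + 1)) / (step t j * (step t j + step t (j + 1))) *
    (1 / (node α t k - s) ^ α)

/-- The coefficient `b_j^k`: as `a_j^k`, for the node `t_j`. -/
noncomputable def coeffB (α : ℝ) (t : ℕ → ℝ) (k j : ℕ) : ℝ :=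
  -∫ s in t (j - 1)..t j, (2 * s - t (j - 1) - t (j + 1)) / (step t j * step t (j + 1)) *
    (1 / (node α t k - s) ^ α)

/-- The coefficient `c_j^k`: as `a_j^k`, for the node `t_{j+1}`. -/
noncomputable def coeffC (α : ℝ) (t : ℕ → ℝ) (k j : ℕ) : ℝ :=
  ∫ s in t (j - 1)..t j,
    (2 * s - t (j - 1) - t j) / (step t (j + 1) * (step t j + step t (j + 1))) *
    (1 / (node α t k - s) ^ α)

/-- The L2-1σ fractional-derivative operator `L_k^{α,*}`, for `k ≥ 1`, on the mesh `t`, applied to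
the sequence `U = (u^0, u^1, …)`. -/
noncomputable def opL {E : Type*} [NormedAddCommGroup E] [NormedSpace ℝ E]
    (α : ℝ) (t : ℕ → ℝ) (U : ℕ → E) (k : ℕ) : E :=
  (Real.Gamma (1 - α))⁻¹ • ∑ j ∈ Finset.Icc 1 (k - 1),
      (coeffA α t k j • U (j - 1) + coeffB α t k j • U j + coeffC α t k j • U (j + 1)) +
    ((1 - α / 2) ^ (1 - α) / (Real.Gamma (2 - α) * step t k ^ α)) • (U k - U (k - 1))

/-- `U^0, …, U^K ∈ H¹₀(Ω)` is a numerical solution of the L2-1σ scheme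
`L_k^{α,*} U = (1 - α/2) Δ U^k + (α/2) Δ U^{k-1} + f(t_k^*)`, `1 ≤ k ≤ K`, with `U^0 = u⁰`
(weak form, continuous in space). -/
def IsSchemeSolution {d : ℕ} {Ω : Set (Space d)} (α : ℝ) (t : ℕ → ℝ) (K : ℕ)
    (f : ℝ → H01 Ω →L[ℝ] ℝ) (u₀ : H01 Ω) (U : ℕ → H01 Ω) : Prop :=
  U 0 = u₀ ∧
    ∀ k ∈ Finset.Icc 1 K, ∀ v : H01 Ω,
      inner ℝ (fn (opL α t U k)) (fn v) =
        -((1 - α / 2) * inner ℝ (weakGrad (U k)) (weakGrad v) +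
            α / 2 * inner ℝ (weakGrad (U (k - 1))) (weakGrad v))
          + f (node α t k) v

/-- The graded mesh `t_j = (j / K)^r T`. -/
noncomputable def gradedMesh (r T : ℝ) (K : ℕ) (j : ℕ) : ℝ := ((j : ℝ) / (K : ℝ)) ^ r * T

end Discrete

end Subdiffusion

/-! The proof is an energy argument in which a discrete maximum principle replaces Grönwall.
Regrouped in differences, the operator is `Γ(1-α) L U = ∑ D_{n,i} (U^{i+1} - U^i)` at step `n + 1`
(`opL_eq_sum`). Write `k(s) = (t* - s)^(-α)` with `t* = t*_{n+1}`. Monotonicity and convexity of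
`k`, together with `3ρ²(1+ρ) ≥ 1`, give the interlacing `D_{n,i} ≤ k(t_{i+1}) ≤ D_{n,i+1}` for `i <
n` (`diffKernel_le`, `le_diffKernel`). So each row is positive and nondecreasing, and its first
entry satisfies `D_{n,0} ≥ t_{n+1}^(-α)`.

Stability. Testing the error equation with `z = σ e^{n+1} + (1-σ) e^n` turns it into a scalar
inequality for `‖e‖²` (`sum_mul_sq_sub_le`). This uses that the last entry is at least `σ/(2σ-1)`
times the one before it. The gradient term of the equation absorbs the `H¹` interpolation error `S`,
which then appears squared, while the truncation error `R` is multiplied by `‖z‖` in `L²`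
(`two_mul_inner_opL_le`). Since `D_{n,0} ≥ t_{n+1}^(-α)`, bounding `t_{n+1}^α ‖R‖` and `‖S‖` by
multiples of `Y = K^(-min(rα,2))` is enough: the maximum principle `le_of_kernel_sum_le` gives `N² ≤
a Y N + b Y²` for the maximal error `N`, hence `N ≤ (a+b+1) Y`.

Consistency. On an interior interval the derivative of the quadratic interpolation error has mean
zero, so only the variation of `k` there counts. On the graded mesh `τ³ t^(α-3)` is of order
`t_{i+1}^α/(i+1)³`, which is at most a multiple of `Y/(i+1)`. The remaining sum of kernel increments
over `i` is split at half of the index range (`sum_sub_div_le`). On the last interval `σ = 1 - α/2`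
makes the kernel orthogonal to `s - midpoint`, so the linear rule is as accurate as a quadratic one.
The interval at `t = 0`, where the third derivative is not controlled, is estimated from the first
derivative alone. -/

namespace Subdiffusion

/-! ### Weighted integrals of quadratic Lagrange basis derivatives. -/

section Quadrature

variable {w : ℝ → ℝ} {a b c D : ℝ}

/-- Monotone integrands bound the first quadratic weight from below. -/
theorem le_neg_weightA (hab : a < b) (hbc : b < c) (hw : ContinuousOn w (Set.Icc a b))
    (hmono : MonotoneOn w (Set.Icc a b)) :
    w a ≤ -∫ s in a..b, (2 * s - b - c) / ((b - a) * ((b - a) + (c - b))) * w s := by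
  have hden : 0 < (b - a) * ((b - a) + (c - b)) := by
    apply mul_pos <;> linarith
  have h1 : ∫ s in a..b, (2 * s - b - c) / ((b - a) * ((b - a) + (c - b))) * w a = - w a := by
    rw [intervalIntegral.integral_mul_const, intervalIntegral.integral_div,
      intervalIntegral.integral_sub, intervalIntegral.integral_sub,
      intervalIntegral.integral_const_mul, integral_id, intervalIntegral.integral_const,
      intervalIntegral.integral_const]
    · have h2 : (b - a) ≠ 0 := by linarith
      have h3 : (b - a) + (c - b) ≠ 0 := by linarith
      simp only [smul_eq_mul]
      field_simp
      ring
    all_goals exact Continuous.intervalIntegrable (by fun_prop) _ _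
  have h2 : (∫ s in a..b, (2 * s - b - c) / ((b - a) * ((b - a) + (c - b))) * w s) ≤
      ∫ s in a..b, (2 * s - b - c) / ((b - a) * ((b - a) + (c - b))) * w a := by
    apply intervalIntegral.integral_mono_on hab.le
    · apply ContinuousOn.intervalIntegrable
      rw [Set.uIcc_of_le hab.le]
      fun_prop
    · exact Continuous.intervalIntegrable (by fun_prop) _ _
    · intro s hs
      apply mul_le_mul_of_nonpos_left
      · exact hmono ⟨le_rfl, hab.le⟩ hs hs.1
      · apply div_nonpos_of_nonpos_of_nonneg _ hden.le
        linarith [hs.2]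
  linarith

/-- The weight is nonpositive with integral `-1`, so the left side averages `w` against a decreasing
probability density. Under such a density the mean distance to `b` is at least `(b - a) / 2`, which
is the source of the deficit. -/
theorem neg_weightA_le (hab : a < b) (hbc : b < c) (hw : ContinuousOn w (Set.Icc a b))
    (hD0 : 0 ≤ D) (hD : ∀ s ∈ Set.Icc a b, w s ≤ w b - D * (b - s)) :
    (-∫ s in a..b, (2 * s - b - c) / ((b - a) * ((b - a) + (c - b))) * w s) ≤
      w b - D * (b - a) / 2 := by
  have hden : 0 < (b - a) * ((b - a) + (c - b)) := by
    apply mul_pos <;> linarith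
  have hid : ∀ s : ℝ, (2 * s - b - c) / ((b - a) * ((b - a) + (c - b))) * (w b - D * (b - s)) =
      ((b - a) * ((b - a) + (c - b)))⁻¹ * (2 * D * s ^ 2 + (2 * (w b - D * b) - D * (b + c)) * s -
        (b + c) * (w b - D * b)) := by
    intro s
    rw [div_eq_inv_mul]
    ring
  have h1 : (∫ s in a..b, (2 * s - b - c) / ((b - a) * ((b - a) + (c - b))) * (w b - D * (b - s)))
      ≥ -(w b - D * (b - a) / 2) := by
    simp_rw [hid]
    rw [intervalIntegral.integral_const_mul, intervalIntegral.integral_sub,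
      intervalIntegral.integral_add,
      intervalIntegral.integral_const_mul, intervalIntegral.integral_const_mul, integral_pow,
      integral_id, intervalIntegral.integral_const]
    · have h2 : 0 < (b - a) := by linarith
      have h3 : 0 < (b - a) + (c - b) := by linarith
      rw [ge_iff_le, le_inv_mul_iff₀ hden]
      simp only [smul_eq_mul]
      have : 0 ≤ D * (b - a) ^ 3 := by positivity
      norm_num only
      linarith
    all_goals exact Continuous.intervalIntegrable (by fun_prop) _ _
  have h2 : (∫ s in a..b, (2 * s - b - c) / ((b - a) * ((b - a) + (c - b))) * (w b - D * (b - s))) ≤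
      ∫ s in a..b, (2 * s - b - c) / ((b - a) * ((b - a) + (c - b))) * w s := by
    apply intervalIntegral.integral_mono_on hab.le
    · exact Continuous.intervalIntegrable (by fun_prop) _ _
    · apply ContinuousOn.intervalIntegrable
      rw [Set.uIcc_of_le hab.le]
      fun_prop
    · intro s hs
      apply mul_le_mul_of_nonpos_left (hD s hs)
      apply div_nonpos_of_nonpos_of_nonneg _ hden.le
      linarith [hs.2]
  linarith

theorem integral_weightC_const (m : ℝ) :
    ∫ s in a..b, (2 * s - a - b) / m = 0 := by
  rw [intervalIntegral.integral_div, intervalIntegral.integral_sub, intervalIntegral.integral_sub,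
      intervalIntegral.integral_const_mul, integral_id, intervalIntegral.integral_const,
      intervalIntegral.integral_const]
  · simp only [smul_eq_mul]
    ring
  all_goals exact Continuous.intervalIntegrable (by fun_prop) _ _

/-- The weight is odd about the midpoint, so subtracting the midpoint value of `w` costs nothing and
makes the integrand nonnegative. The degenerate case `a = b` is allowed because it occurs for index
`0`. -/
theorem weightC_nonneg (hab : a ≤ b) {m : ℝ} (hm : 0 ≤ m) (hw : ContinuousOn w (Set.Icc a b))
    (hmono : MonotoneOn w (Set.Icc a b)) :
    0 ≤ ∫ s in a..b, (2 * s - a - b) / m * w s := by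
  have h1 : ∫ s in a..b, (2 * s - a - b) / m * w ((a + b) / 2) = 0 := by
    rw [intervalIntegral.integral_mul_const, integral_weightC_const, zero_mul]
  rw [← h1]
  have hmid : (a + b) / 2 ∈ Set.Icc a b := ⟨by linarith, by linarith⟩
  apply intervalIntegral.integral_mono_on hab
  · exact Continuous.intervalIntegrable (by fun_prop) _ _
  · apply ContinuousOn.intervalIntegrable
    rw [Set.uIcc_of_le hab]
    fun_prop
  · intro s hs
    rcases le_total s ((a + b) / 2) with h | h
    · apply mul_le_mul_of_nonpos_left (hmono hs hmid h)
      exact div_nonpos_of_nonpos_of_nonneg (by linarith) hm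
    · apply mul_le_mul_of_nonneg_left (hmono hmid hs h)
      exact div_nonneg (by linarith) hm

/-- The slope bound makes `D * s - w s` nondecreasing, so `weightC_nonneg` compares `w` with a
linear function, for which the integral is explicit. -/
theorem weightC_le (hab : a ≤ b) {m : ℝ} (hm : 0 ≤ m) (hw : ContinuousOn w (Set.Icc a b))
    (hD : ∀ s ∈ Set.Icc a b, ∀ s' ∈ Set.Icc a b, s ≤ s' → w s' - w s ≤ D * (s' - s)) :
    (∫ s in a..b, (2 * s - a - b) / m * w s) ≤ D * (b - a) ^ 3 / (6 * m) := by
  have hmid : (a + b) / 2 ∈ Set.Icc a b := ⟨by linarith, by linarith⟩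
  have h0 := weightC_nonneg (w := fun s => D * s - w s) hab hm (by fun_prop) (by
    intro s hs s' hs' hss
    have := hD s hs s' hs' hss
    simp only
    linarith)
  have h1 : ∫ s in a..b, (2 * s - a - b) / m * (D * s) = D * (b - a) ^ 3 / (6 * m) := by
    have : ∀ s : ℝ, (2 * s - a - b) / m * (D * s) = D / m * (2 * s ^ 2 - (a + b) * s) := by
      intro s; ring
    simp_rw [this]
    rw [intervalIntegral.integral_const_mul, intervalIntegral.integral_sub,
      intervalIntegral.integral_const_mul, intervalIntegral.integral_const_mul, integral_pow,
      integral_id]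
    · rcases eq_or_ne m 0 with rfl | hm
      · simp
      · field_simp
        norm_num
        ring
    all_goals exact Continuous.intervalIntegrable (by fun_prop) _ _
  simp only [mul_sub] at h0
  rw [intervalIntegral.integral_sub, h1] at h0
  · linarith
  · exact Continuous.intervalIntegrable (by fun_prop) _ _
  · apply ContinuousOn.intervalIntegrable
    rw [Set.uIcc_of_le hab]
    fun_prop

end Quadrature

/-! ### The singular kernel: monotonicity and slope bounds. -/

section Kernel

variable {α x : ℝ}

theorem hasDerivAt_kernel {s : ℝ} (hs : s < x) :
    HasDerivAt (fun s => 1 / (x - s) ^ α) (α * (x - s) ^ (-α - 1)) s := by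
  have h1 : HasDerivAt (fun s => x - s) (-1) s := by
    simpa using (hasDerivAt_id s).const_sub x
  have h2 := h1.rpow_const (p := -α) (Or.inl (by linarith : x - s ≠ 0))
  have h3 : HasDerivAt (fun s => (x - s) ^ (-α)) (α * (x - s) ^ (-α - 1)) s := by
    convert h2 using 1
    ring
  refine h3.congr_of_eventuallyEq ?_
  filter_upwards [eventually_lt_nhds hs] with y hy
  rw [Real.rpow_neg (by linarith), one_div]

theorem continuousOn_kernel {a b : ℝ} (hb : b < x) :
    ContinuousOn (fun s => 1 / (x - s) ^ α) (Set.Icc a b) := fun _ hs =>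
  (hasDerivAt_kernel (lt_of_le_of_lt hs.2 hb)).continuousAt.continuousWithinAt

theorem kernel_pos {s : ℝ} (hs : s < x) : 0 < 1 / (x - s) ^ α := by
  have : 0 < x - s := by linarith
  positivity

theorem kernel_mono (hα : 0 < α) {s s' : ℝ} (hs' : s' < x) (h : s ≤ s') :
    1 / (x - s) ^ α ≤ 1 / (x - s') ^ α := by
  apply one_div_le_one_div_of_le
  · have : 0 < x - s' := by linarith
    positivity
  · exact Real.rpow_le_rpow (by linarith) (by linarith) hα.le

theorem monotoneOn_kernel (hα : 0 < α) {a b : ℝ} (hb : b < x) :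
    MonotoneOn (fun s => 1 / (x - s) ^ α) (Set.Icc a b) := fun _ _ _ hs' h =>
  kernel_mono hα (lt_of_le_of_lt hs'.2 hb) h

theorem exists_kernel_slope {s s' : ℝ} (hs' : s' < x) (h : s < s') :
    ∃ y ∈ Set.Ioo s s', 1 / (x - s') ^ α - 1 / (x - s) ^ α =
      α * (x - y) ^ (-α - 1) * (s' - s) := by
  obtain ⟨y, hy, hy'⟩ := exists_hasDerivAt_eq_slope (fun s => 1 / (x - s) ^ α)
    (fun s => α * (x - s) ^ (-α - 1)) h (continuousOn_kernel hs')
    (fun y hy => hasDerivAt_kernel (hy.2.trans hs'))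
  refine ⟨y, hy, ?_⟩
  rw [hy']
  field_simp [sub_ne_zero.2 h.ne']

/-- The kernel is convex in `s`: its slope is largest at the right end and smallest at the left end.
This bound and `le_kernel_sub` are later applied on the two sides of one mesh point, so that both
involve the slope at that point. -/
theorem kernel_sub_le (hα : 0 < α) {s s' b : ℝ} (hb : b < x) (hs' : s' ≤ b) (h : s ≤ s') :
    1 / (x - s') ^ α - 1 / (x - s) ^ α ≤ α * (x - b) ^ (-α - 1) * (s' - s) := by
  rcases h.eq_or_lt with rfl | h
  · simp
  obtain ⟨y, hy, hy'⟩ := exists_kernel_slope (α := α) (lt_of_le_of_lt hs' hb) h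
  rw [hy']
  have := Real.rpow_le_rpow_of_nonpos (x := x - b) (y := x - y) (z := -α - 1)
    (by linarith) (by linarith [hy.2]) (by linarith)
  have h2 : 0 ≤ s' - s := by linarith
  gcongr

theorem le_kernel_sub (hα : 0 < α) {s s' a : ℝ} (hs : a ≤ s) (hs' : s' < x) (h : s ≤ s') :
    α * (x - a) ^ (-α - 1) * (s' - s) ≤ 1 / (x - s') ^ α - 1 / (x - s) ^ α := by
  rcases h.eq_or_lt with rfl | h
  · simp
  obtain ⟨y, hy, hy'⟩ := exists_kernel_slope (α := α) hs' h
  rw [hy']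
  have := Real.rpow_le_rpow_of_nonpos (x := x - y) (y := x - a) (z := -α - 1)
    (by linarith [hy.2]) (by linarith [hy.1]) (by linarith)
  have h2 : 0 ≤ s' - s := by linarith
  gcongr

end Kernel

/-! ### The operator in difference form, and monotonicity of its kernel. -/

section DiscreteKernel

/-- The coefficient of `U (i + 1) - U i` in `Γ(1 - α) * opL α t U (n + 1)`. -/
noncomputable def diffKernel (α : ℝ) (t : ℕ → ℝ) (n i : ℕ) : ℝ :=
  coeffC α t (n + 1) i +
    if i = n then (1 - α / 2) ^ (1 - α) / ((1 - α) * step t (n + 1) ^ α)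
    else -coeffA α t (n + 1) (i + 1)

variable {α : ℝ} {t : ℕ → ℝ}

/-- Natural subtraction gives `0 - 1 = 0`, so the integral is over a degenerate interval. Hence the
formula of `diffKernel` needs no separate case at `i = 0`. -/
theorem coeffC_zero (k : ℕ) : coeffC α t k 0 = 0 := by
  simp [coeffC]

theorem step_pos (ht : StrictMono t) {j : ℕ} (hj : 1 ≤ j) : 0 < step t j :=
  sub_pos.2 (ht (by omega))

theorem node_succ (n : ℕ) : node α t (n + 1) = t n + (1 - α / 2) * step t (n + 1) := rfl

theorem lt_node (hα1 : α < 1) (ht : StrictMono t) {n j : ℕ} (hj : j ≤ n) :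
    t j < node α t (n + 1) := by
  rw [node_succ]
  have h1 := ht.monotone hj
  have h2 := step_pos ht (Nat.le_add_left 1 n)
  nlinarith

theorem node_le (hα0 : 0 < α) (ht : StrictMono t) (n : ℕ) : node α t (n + 1) ≤ t (n + 1) := by
  rw [node_succ]
  have h2 := step_pos ht (Nat.le_add_left 1 n)
  have h3 : step t (n + 1) = t (n + 1) - t n := rfl
  nlinarith

/-- The three Lagrange basis functions sum to `1`, so their derivatives sum to `0`. This is what
allows regrouping into differences. -/
theorem coeff_sum (hα1 : α < 1) (ht : StrictMono t) {n j : ℕ} (hj : j + 1 ≤ n) :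
    coeffB α t (n + 1) (j + 1) =
      -coeffA α t (n + 1) (j + 1) - coeffC α t (n + 1) (j + 1) := by
  have hc : ContinuousOn (fun s => 1 / (node α t (n + 1) - s) ^ α) (Set.uIcc (t j) (t (j + 1))) := by
    rw [Set.uIcc_of_le (ht.monotone (by omega))]
    exact continuousOn_kernel (lt_node hα1 ht hj)
  unfold coeffA coeffB coeffC
  simp only [Nat.add_sub_cancel]
  rw [← neg_add', ← intervalIntegral.integral_add]
  · congr 1
    apply intervalIntegral.integral_congr
    intro s _
    have h1 := (step_pos ht (Nat.le_add_left 1 j))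
    have h2 := (step_pos ht (Nat.le_add_left 1 (j + 1)))
    simp only
    rw [← add_mul]
    congr 1
    have e1 : t (j + 1) = t j + step t (j + 1) := by simp [step]
    have e2 : t (j + 1 + 1) = t j + step t (j + 1) + step t (j + 1 + 1) := by simp [step]
    rw [e2, e1]
    field_simp
    ring
  all_goals
    apply ContinuousOn.intervalIntegrable
    fun_prop

theorem last_coeff_opL (hα1 : α < 1) (y : ℝ) :
    (1 - α / 2) ^ (1 - α) / (Real.Gamma (2 - α) * y ^ α) =
      (Real.Gamma (1 - α))⁻¹ * ((1 - α / 2) ^ (1 - α) / ((1 - α) * y ^ α)) := by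
  have hΓ : Real.Gamma (2 - α) = (1 - α) * Real.Gamma (1 - α) := by
    rw [← Real.Gamma_add_one (by linarith)]
    congr 1
    ring
  rw [hΓ, inv_mul_eq_div, div_div]
  ring_nf

theorem opL_eq_sum {E : Type*} [NormedAddCommGroup E] [NormedSpace ℝ E] (hα1 : α < 1)
    (ht : StrictMono t) (U : ℕ → E) (n : ℕ) :
    opL α t U (n + 1) = (Real.Gamma (1 - α))⁻¹ •
      ∑ i ∈ Finset.range (n + 1), diffKernel α t n i • (U (i + 1) - U i) := by
  have hsum : ∑ j ∈ Finset.Icc 1 n, (coeffA α t (n + 1) j • U (j - 1) +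
      coeffB α t (n + 1) j • U j + coeffC α t (n + 1) j • U (j + 1)) =
      ∑ i ∈ Finset.range n, (-coeffA α t (n + 1) (i + 1)) • (U (i + 1) - U i) +
      ∑ i ∈ Finset.range (n + 1), coeffC α t (n + 1) i • (U (i + 1) - U i) := by
    have hIcc : Finset.Icc 1 n = Finset.Ico (0 + 1) (n + 1) := by
      ext j
      simp
    rw [Finset.sum_range_succ', coeffC_zero, zero_smul, add_zero, ← Finset.sum_add_distrib,
      Finset.range_eq_Ico, hIcc, ← Finset.sum_Ico_add']
    apply Finset.sum_congr rfl
    intro j hj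
    rw [coeff_sum hα1 ht (by simp at hj; omega)]
    simp only [Nat.add_sub_cancel]
    module
  unfold opL
  rw [Nat.add_sub_cancel, hsum, last_coeff_opL hα1, mul_smul, ← smul_add]
  congr 1
  simp only [diffKernel, add_smul, Finset.sum_add_distrib]
  rw [add_comm (∑ i ∈ Finset.range n, _), add_assoc]
  congr 1
  rw [Finset.sum_range_succ]
  simp only [if_true]
  congr 1
  apply Finset.sum_congr rfl
  intro i hi
  rw [if_neg (by simp at hi; omega)]

theorem coeffC_nonneg (hα0 : 0 < α) (hα1 : α < 1) (ht : StrictMono t) {n j : ℕ} (hj : j ≤ n) :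
    0 ≤ coeffC α t (n + 1) j := by
  have h1 : t j < node α t (n + 1) := lt_node hα1 ht hj
  have h2 := (step_pos ht (Nat.le_add_left 1 j))
  have h0 : 0 ≤ step t j := sub_nonneg.2 (ht.monotone (by omega))
  exact weightC_nonneg (ht.monotone (by omega)) (by positivity) (continuousOn_kernel h1)
    (monotoneOn_kernel hα0 h1)

theorem le_neg_coeffA (hα0 : 0 < α) (hα1 : α < 1) (ht : StrictMono t) {n j : ℕ} (hj : j + 1 ≤ n) :
    1 / (node α t (n + 1) - t j) ^ α ≤ -coeffA α t (n + 1) (j + 1) := by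
  have h1 : t (j + 1) < node α t (n + 1) := lt_node hα1 ht hj
  exact le_neg_weightA (w := fun s => 1 / (node α t (n + 1) - s) ^ α)
    (ht (Nat.lt_succ_self j)) (ht (Nat.lt_succ_self (j + 1))) (continuousOn_kernel h1)
    (monotoneOn_kernel hα0 h1)

theorem neg_coeffA_le (hα0 : 0 < α) (hα1 : α < 1) (ht : StrictMono t) {n j : ℕ} (hj : j + 1 ≤ n) :
    -coeffA α t (n + 1) (j + 1) ≤ 1 / (node α t (n + 1) - t (j + 1)) ^ α -
      α * (node α t (n + 1) - t j) ^ (-α - 1) * step t (j + 1) / 2 := by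
  have h1 : t (j + 1) < node α t (n + 1) := lt_node hα1 ht hj
  have h0 : t j < node α t (n + 1) := lt_node hα1 ht (by omega)
  have h2 : 0 < node α t (n + 1) - t j := by linarith
  refine neg_weightA_le (w := fun s => 1 / (node α t (n + 1) - s) ^ α)
    (ht (Nat.lt_succ_self j)) (ht (Nat.lt_succ_self (j + 1))) (continuousOn_kernel h1)
    (by positivity) ?_
  intro s hs
  have := le_kernel_sub hα0 hs.1 h1 hs.2
  simp only [Nat.add_sub_cancel] at this hs ⊢
  linarith

theorem coeffC_le (hα0 : 0 < α) (hα1 : α < 1) (ht : StrictMono t) {n j : ℕ} (hj : j ≤ n) :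
    coeffC α t (n + 1) j ≤ α * (node α t (n + 1) - t j) ^ (-α - 1) * step t j ^ 3 /
      (6 * (step t (j + 1) * (step t j + step t (j + 1)))) := by
  have h1 : t j < node α t (n + 1) := lt_node hα1 ht hj
  have h2 := (step_pos ht (Nat.le_add_left 1 j))
  have h0 : 0 ≤ step t j := sub_nonneg.2 (ht.monotone (by omega))
  exact weightC_le (ht.monotone (by omega)) (by positivity) (continuousOn_kernel h1)
    (fun s _ s' hs' h => kernel_sub_le hα0 h1 hs'.2 h)

/-- Here `t* - t n = σ τ`. The factor is `σ / (2σ - 1)`, exactly what the coercivity estimate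
requires of the last entry. -/
theorem last_coeff_eq (hα0 : 0 < α) (hα1 : α < 1) (ht : StrictMono t) (n : ℕ) :
    (1 - α / 2) ^ (1 - α) / ((1 - α) * step t (n + 1) ^ α) =
      (1 - α / 2) / (1 - α) * (1 / (node α t (n + 1) - t n) ^ α) := by
  have hσ : 0 < 1 - α / 2 := by linarith
  have h2 := step_pos ht (Nat.le_add_left 1 n)
  rw [node_succ, add_sub_cancel_left, Real.mul_rpow hσ.le h2.le, Real.rpow_sub hσ, Real.rpow_one]
  have : 0 < (1 - α / 2) ^ α := by positivity
  have : 0 < step t (n + 1) ^ α := by positivity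
  have : 1 - α ≠ 0 := by linarith
  field_simp

theorem le_diffKernel_last (hα0 : 0 < α) (hα1 : α < 1) (ht : StrictMono t) (n : ℕ) :
    (1 - α / 2) / (1 - α) * (1 / (node α t (n + 1) - t n) ^ α) ≤ diffKernel α t n n := by
  rw [diffKernel, if_pos rfl, last_coeff_eq hα0 hα1 ht]
  linarith [coeffC_nonneg hα0 hα1 ht (le_refl n)]

theorem le_diffKernel (hα0 : 0 < α) (hα1 : α < 1) (ht : StrictMono t) {n i : ℕ} (hi : i ≤ n) :
    1 / (node α t (n + 1) - t i) ^ α ≤ diffKernel α t n i := by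
  rcases hi.eq_or_lt with rfl | hi
  · refine le_trans ?_ (le_diffKernel_last hα0 hα1 ht i)
    have := kernel_pos (α := α) (lt_node hα1 ht (le_refl i))
    apply le_mul_of_one_le_left this.le
    rw [one_le_div (by linarith)]
    linarith
  · rw [diffKernel, if_neg hi.ne]
    have := coeffC_nonneg hα0 hα1 ht hi.le
    have := le_neg_coeffA hα0 hα1 ht hi
    linarith

/-- The `a`-part lies below the kernel value at `t (i + 1)` by at least `W τ_{i+1} / 2`, where `W`
is the kernel slope at `t i`. The `c`-part adds at most `W τ_i³ / (6 τ_{i+1} (τ_i + τ_{i+1}))`. The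
ratio condition says exactly that the gain does not exceed the deficit; for `i = 0` there is no
gain. -/
theorem diffKernel_le (hα0 : 0 < α) (hα1 : α < 1) (ht : StrictMono t) {n i : ℕ} (hi : i < n)
    (hratio : 1 ≤ i → 1 ≤ 3 * ratio t (i + 1) ^ 2 * (1 + ratio t (i + 1))) :
    diffKernel α t n i ≤ 1 / (node α t (n + 1) - t (i + 1)) ^ α := by
  have h1 := neg_coeffA_le hα0 hα1 ht hi
  have h3 : 0 < node α t (n + 1) - t i := by
    have := lt_node hα1 ht hi.le
    linarith
  have hp := step_pos ht (Nat.le_add_left 1 i)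
  rw [diffKernel, if_neg hi.ne]
  set W := α * (node α t (n + 1) - t i) ^ (-α - 1) with hW
  have hW0 : 0 ≤ W := by positivity
  rcases Nat.eq_zero_or_pos i with h0 | h0
  · subst h0
    rw [coeffC_zero]
    have : 0 ≤ W * step t (0 + 1) / 2 := by positivity
    linarith
  · have h2 := coeffC_le hα0 hα1 ht hi.le
    have hq := step_pos ht h0
    have hr := hratio h0
    have e : ratio t (i + 1) = step t (i + 1) / step t i := rfl
    have key : step t i ^ 3 / (6 * (step t (i + 1) * (step t i + step t (i + 1)))) ≤
        step t (i + 1) / 2 := by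
      rw [e] at hr
      rw [div_le_div_iff₀ (by positivity) (by norm_num)]
      have : 3 * (step t (i + 1) / step t i) ^ 2 * (1 + step t (i + 1) / step t i) =
        3 * step t (i + 1) ^ 2 * (step t i + step t (i + 1)) / step t i ^ 3 := by
        field_simp
      rw [this, one_le_div (by positivity)] at hr
      nlinarith
    have h4 := mul_le_mul_of_nonneg_left key hW0
    rw [← hW, mul_div_assoc] at h2
    rw [mul_div_assoc] at h1
    linarith

end DiscreteKernel

/-! ### Summation by parts, the discrete maximum principle and coercivity. -/

section Monotone

/-- Summation by parts; the interior terms `(D (i + 1) - D i) * d (i + 1)` are nonnegative and are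
dropped. -/
theorem le_sum_mul_sub {D d : ℕ → ℝ} (m : ℕ) (hD : ∀ i < m, D i ≤ D (i + 1))
    (hd : ∀ i, 1 ≤ i → i ≤ m → 0 ≤ d i) :
    D 0 * d 0 - D m * d (m + 1) ≤ ∑ i ∈ Finset.range (m + 1), D i * (d i - d (i + 1)) := by
  induction m with
  | zero => simp [mul_sub]
  | succ m ih =>
    rw [Finset.sum_range_succ]
    have h1 := ih (fun i hi => hD i (by omega)) (fun i h1 h2 => hd i h1 (by omega))
    have h2 := mul_le_mul_of_nonneg_right (hD m (by omega)) (hd (m + 1) (by omega) le_rfl)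
    linarith

/-- Discrete maximum principle for a triangular kernel with nonnegative nondecreasing rows. -/
theorem le_of_kernel_sum_le {D : ℕ → ℕ → ℝ} {v : ℕ → ℝ} {M : ℝ} (hM : 0 ≤ M) (N : ℕ)
    (hpos : ∀ n < N, 0 < D n n) (hD : ∀ n < N, ∀ i < n, D n i ≤ D n (i + 1))
    (hsum : ∀ n < N, ∑ i ∈ Finset.range (n + 1), D n i * (v (i + 1) - v i) ≤ D n 0 * M)
    {k : ℕ} (hk : k ≤ N) : v k ≤ v 0 + M := by
  induction k using Nat.strong_induction_on with
  | _ k ih =>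
    rcases k with _ | n
    · linarith
    have hn : n < N := hk
    -- The gap `v 0 + M - v i` equals `M` at `i = 0`, so the boundary term cancels the right side of
    -- `hsum` and only the sign of the new gap remains.
    have h1 := le_sum_mul_sub (D := D n) (d := fun i => v 0 + M - v i) n (hD n hn)
      (fun i _ hi => sub_nonneg.2 (ih i (by omega) (by omega)))
    have h2 := hsum n hn
    have h3 : ∑ i ∈ Finset.range (n + 1), D n i * (v (i + 1) - v i) =
        ∑ i ∈ Finset.range (n + 1), D n i * ((v 0 + M - v i) - (v 0 + M - v (i + 1))) :=
      Finset.sum_congr rfl fun i _ => by ring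
    have h4 : 0 ≤ D n n * (v 0 + M - v (n + 1)) := by
      simp only [add_sub_cancel_left] at h1
      linarith
    have := nonneg_of_mul_nonneg_right h4 (hpos n hn)
    linarith

/-- By polarization the two sides differ by `∑ D i (‖x - e i‖² - ‖x - e (i+1)‖²)`, where `x` is the
weighted average. Its last term is `(2σ - 1) D n ‖e (n+1) - e n‖²`; by summation by parts the others
are at least `-σ² D (n-1) ‖e (n+1) - e n‖²`, and `hlast` with `σ ≤ 1` compensates this. -/
theorem sum_mul_sq_sub_le {H : Type*} [NormedAddCommGroup H] [InnerProductSpace ℝ H]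
    {D : ℕ → ℝ} (e : ℕ → H) (n : ℕ) {σ : ℝ} (hσ : 1 / 2 ≤ σ) (hσ1 : σ ≤ 1) (hD0 : 0 ≤ D 0)
    (hD : ∀ i < n, D i ≤ D (i + 1))
    (hlast : ∀ i, i + 1 = n → D i * σ ≤ (2 * σ - 1) * D n) :
    ∑ i ∈ Finset.range (n + 1), D i * (‖e (i + 1)‖ ^ 2 - ‖e i‖ ^ 2) ≤
      2 * inner ℝ (∑ i ∈ Finset.range (n + 1), D i • (e (i + 1) - e i))
        (σ • e (n + 1) + (1 - σ) • e n) := by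
  set x := σ • e (n + 1) + (1 - σ) • e n with hx
  have hid : ∀ i, 2 * inner ℝ (e (i + 1) - e i) x =
      (‖e (i + 1)‖ ^ 2 - ‖e i‖ ^ 2) + (‖x - e i‖ ^ 2 - ‖x - e (i + 1)‖ ^ 2) := by
    intro i
    rw [norm_sub_sq_real, norm_sub_sq_real, inner_sub_left, real_inner_comm, real_inner_comm x (e i)]
    ring
  have h1 : 2 * inner ℝ (∑ i ∈ Finset.range (n + 1), D i • (e (i + 1) - e i)) x =
      ∑ i ∈ Finset.range (n + 1), D i * (‖e (i + 1)‖ ^ 2 - ‖e i‖ ^ 2) +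
      ∑ i ∈ Finset.range (n + 1), D i * (‖x - e i‖ ^ 2 - ‖x - e (i + 1)‖ ^ 2) := by
    rw [sum_inner, Finset.mul_sum, ← Finset.sum_add_distrib]
    apply Finset.sum_congr rfl
    intro i _
    rw [real_inner_smul_left, ← mul_add, ← hid]
    ring
  rw [h1]
  have hn1 : ‖x - e (n + 1)‖ ^ 2 = (1 - σ) ^ 2 * ‖e (n + 1) - e n‖ ^ 2 := by
    have : x - e (n + 1) = (-(1 - σ)) • (e (n + 1) - e n) := by
      rw [hx]
      module
    rw [this, norm_smul, mul_pow, Real.norm_eq_abs, sq_abs]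
    ring
  have hn0 : ‖x - e n‖ ^ 2 = σ ^ 2 * ‖e (n + 1) - e n‖ ^ 2 := by
    have : x - e n = σ • (e (n + 1) - e n) := by
      rw [hx]
      module
    rw [this, norm_smul, mul_pow, Real.norm_eq_abs, sq_abs]
  suffices h : 0 ≤ ∑ i ∈ Finset.range (n + 1), D i * (‖x - e i‖ ^ 2 - ‖x - e (i + 1)‖ ^ 2) by
    linarith
  have hq : 0 ≤ ‖e (n + 1) - e n‖ ^ 2 := by positivity
  rw [Finset.sum_range_succ, hn1, hn0]
  rcases n with _ | m
  · simp only [Finset.range_zero, Finset.sum_empty, zero_add]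
    have : 0 ≤ D 0 * ((2 * σ - 1) * ‖e (0 + 1) - e 0‖ ^ 2) :=
      mul_nonneg hD0 (mul_nonneg (by linarith) hq)
    simp only [zero_add] at this
    linarith
  · have h2 := le_sum_mul_sub (D := D) (d := fun i => ‖x - e i‖ ^ 2) m (fun i hi => hD i (by omega))
      (fun i _ _ => by positivity)
    rw [hn0] at h2
    have h3 : 0 ≤ D 0 * ‖x - e 0‖ ^ 2 := by positivity
    have h4 := hlast m rfl
    have h0 : ∀ j, j ≤ m → 0 ≤ D j := by
      intro j
      induction j with
      | zero => intro _; exact hD0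
      | succ j ih => intro hj; exact (ih (by omega)).trans (hD j (by omega))
    have h5 : D m * σ ^ 2 ≤ D m * σ := by
      apply mul_le_mul_of_nonneg_left _ (h0 m le_rfl)
      nlinarith
    have h6 : 0 ≤ ((2 * σ - 1) * D (m + 1) - D m * σ ^ 2) * ‖e (m + 1 + 1) - e (m + 1)‖ ^ 2 :=
      mul_nonneg (by linarith) hq
    linarith

end Monotone

/-! ### Size, step and ratio estimates for the graded mesh. -/

section Mesh

variable {r T : ℝ} {K : ℕ}

theorem gradedMesh_zero (hr : 0 < r) : gradedMesh r T K 0 = 0 := by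
  simp [gradedMesh, Real.zero_rpow hr.ne']

theorem gradedMesh_strictMono (hr : 0 < r) (hT : 0 < T) (hK : 1 ≤ K) :
    StrictMono (gradedMesh r T K) := by
  intro i j hij
  unfold gradedMesh
  have hK' : (0 : ℝ) < K := by exact_mod_cast hK
  have : (i : ℝ) < j := by exact_mod_cast hij
  gcongr

theorem gradedMesh_pos (hr : 0 < r) (hT : 0 < T) (hK : 1 ≤ K) {k : ℕ} (hk : 1 ≤ k) :
    0 < gradedMesh r T K k := by
  have h := gradedMesh_strictMono hr hT hK (show 0 < k from hk)
  rwa [gradedMesh_zero hr] at h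

theorem gradedMesh_le (hr : 0 < r) (hT : 0 < T) (hK : 1 ≤ K) {k : ℕ} (hk : k ≤ K) :
    gradedMesh r T K k ≤ T := by
  have h := (gradedMesh_strictMono hr hT hK).monotone hk
  have hK' : (K : ℝ) ≠ 0 := by positivity
  simpa [gradedMesh, hK'] using h

theorem gradedMesh_le_rpow_mul (hr : 0 < r) (hT : 0 < T) {c : ℝ} (hc : 0 ≤ c) {i j : ℕ}
    (hij : (i : ℝ) ≤ c * j) : gradedMesh r T K i ≤ c ^ r * gradedMesh r T K j := by
  unfold gradedMesh
  rw [← mul_assoc, ← Real.mul_rpow hc (by positivity)]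
  gcongr
  rw [← mul_div_assoc]
  gcongr

theorem gradedMesh_succ_le (hr : 0 < r) (hT : 0 < T) {k : ℕ} (hk : 1 ≤ k) :
    gradedMesh r T K (k + 1) ≤ 2 ^ r * gradedMesh r T K k := by
  apply gradedMesh_le_rpow_mul hr hT (by norm_num)
  have : (1 : ℝ) ≤ k := by exact_mod_cast hk
  push_cast
  linarith

theorem step_gradedMesh (k : ℕ) (hk : 1 ≤ k) :
    step (gradedMesh r T K) k = gradedMesh r T K k * (1 - (1 + -(1 / (k : ℝ))) ^ r) := by
  have hk' : (1 : ℝ) ≤ k := by exact_mod_cast hk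
  have h1 : (1 : ℝ) / k ≤ 1 := by rw [div_le_one (by linarith)]; exact hk'
  have h2 : (((k - 1 : ℕ) : ℝ) / K) = (1 + -(1 / (k : ℝ))) * (k / K) := by
    rw [Nat.cast_sub hk]
    field_simp
    push_cast
    ring
  unfold step gradedMesh
  rw [h2, Real.mul_rpow (by linarith) (by positivity)]
  ring

/-- For `r ≤ 1` this is Bernoulli's inequality; for `r ≥ 1` it is monotonicity of powers of a number
in `[0, 1]` in the exponent. The upper bound `step_gradedMesh_le` exchanges the two cases. -/
theorem le_step_gradedMesh (hr : 0 < r) (hT : 0 < T) {k : ℕ} (hk : 1 ≤ k) :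
    min r 1 * gradedMesh r T K k / k ≤ step (gradedMesh r T K) k := by
  have hk' : (1 : ℝ) ≤ k := by exact_mod_cast hk
  have h1 : (1 : ℝ) / k ≤ 1 := by rw [div_le_one (by linarith)]; exact hk'
  have h0 : 0 < (1 : ℝ) / k := by positivity
  have ht : 0 ≤ gradedMesh r T K k := by unfold gradedMesh; positivity
  rw [step_gradedMesh k hk]
  have key : min r 1 * (1 / (k : ℝ)) ≤ 1 - (1 + -(1 / (k : ℝ))) ^ r := by
    rcases le_total r 1 with h | h
    · have := rpow_one_add_le_one_add_mul_self (s := -(1 / (k : ℝ))) (by linarith) hr.le h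
      rw [min_eq_left h]
      linarith
    · have := Real.rpow_le_rpow_of_exponent_ge' (x := 1 + -(1 / (k : ℝ))) (by linarith)
        (by linarith) zero_le_one h
      rw [Real.rpow_one] at this
      rw [min_eq_right h]
      linarith
  calc _ = gradedMesh r T K k * (min r 1 * (1 / (k : ℝ))) := by ring
    _ ≤ _ := by gcongr

theorem step_gradedMesh_le (hr : 0 < r) (hT : 0 < T) {k : ℕ} (hk : 1 ≤ k) :
    step (gradedMesh r T K) k ≤ max r 1 * gradedMesh r T K k / k := by
  have hk' : (1 : ℝ) ≤ k := by exact_mod_cast hk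
  have h1 : (1 : ℝ) / k ≤ 1 := by rw [div_le_one (by linarith)]; exact hk'
  have h0 : 0 < (1 : ℝ) / k := by positivity
  have ht : 0 ≤ gradedMesh r T K k := by unfold gradedMesh; positivity
  rw [step_gradedMesh k hk]
  have key : 1 - (1 + -(1 / (k : ℝ))) ^ r ≤ max r 1 * (1 / (k : ℝ)) := by
    rcases le_total r 1 with h | h
    · have := Real.rpow_le_rpow_of_exponent_ge' (x := 1 + -(1 / (k : ℝ))) (by linarith)
        (by linarith) hr.le h
      rw [Real.rpow_one] at this
      rw [max_eq_right h]
      linarith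
    · have := one_add_mul_self_le_rpow_one_add (s := -(1 / (k : ℝ))) (by linarith) h
      rw [max_eq_left h]
      linarith
  calc _ ≤ gradedMesh r T K k * (max r 1 * (1 / (k : ℝ))) := by gcongr
    _ = _ := by ring

/-- Every local error is converted into the final rate here. As `k / K ≤ 1`, the exponent `rα` may
be lowered to the minimum, and then `k` to that power is at most `k²`. The factor `k²` is paid for
by powers of `τ_k / t_k`, of order `1 / k`. -/
theorem gradedMesh_rpow_le (hr : 0 < r) (hT : 0 < T) {α : ℝ} (hα : 0 < α) {k : ℕ} (hk : 1 ≤ k)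
    (hkK : k ≤ K) :
    gradedMesh r T K k ^ α ≤ T ^ α * (k : ℝ) ^ 2 / (K : ℝ) ^ min (r * α) 2 := by
  have hk' : (1 : ℝ) ≤ k := by exact_mod_cast hk
  have hkK' : (k : ℝ) ≤ K := by exact_mod_cast hkK
  unfold gradedMesh
  rw [Real.mul_rpow (by positivity) hT.le, ← Real.rpow_mul (by positivity), mul_comm, mul_div_assoc]
  gcongr
  have hq : 0 ≤ min (r * α) 2 := le_min (by positivity) (by norm_num)
  calc ((k : ℝ) / K) ^ (r * α) ≤ ((k : ℝ) / K) ^ min (r * α) 2 := by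
        apply Real.rpow_le_rpow_of_exponent_ge' (by positivity) _ hq (min_le_left _ _)
        rw [div_le_one (by linarith)]
        exact hkK'
    _ = (k : ℝ) ^ min (r * α) 2 / (K : ℝ) ^ min (r * α) 2 := Real.div_rpow (by positivity)
        (by positivity) _
    _ ≤ _ := by
        gcongr
        calc (k : ℝ) ^ min (r * α) 2 ≤ (k : ℝ) ^ (2 : ℝ) :=
            Real.rpow_le_rpow_of_exponent_le hk' (min_le_right _ _)
          _ = _ := by norm_num

theorem one_le_ratio_gradedMesh (hr : 1 ≤ r) (hT : 0 < T) (hK : 1 ≤ K) {k : ℕ} (hk : 2 ≤ k) :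
    1 ≤ ratio (gradedMesh r T K) k := by
  obtain ⟨m, rfl⟩ : ∃ m, k = m + 2 := ⟨k - 2, by omega⟩
  have ht := gradedMesh_strictMono (r := r) (T := T) (K := K) (by linarith) hT hK
  have h1 := step_pos ht (Nat.le_add_left 1 m)
  unfold ratio
  rw [show m + 2 - 1 = m + 1 from rfl, one_le_div h1]
  have hm : (m : ℝ) / K ∈ Set.Ici 0 := by
    simp only [Set.mem_Ici]
    positivity
  have hm2 : ((m + 2 : ℕ) : ℝ) / K ∈ Set.Ici 0 := by
    simp only [Set.mem_Ici]
    positivity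
  -- Midpoint convexity of `x ^ r` at three consecutive nodes says that the steps are nondecreasing.
  have hc := (convexOn_rpow hr).2 hm hm2 (by norm_num : (0 : ℝ) ≤ 1 / 2)
    (by norm_num : (0 : ℝ) ≤ 1 / 2) (by norm_num)
  have e : (1 / 2 : ℝ) • ((m : ℝ) / K) + (1 / 2 : ℝ) • (((m + 2 : ℕ) : ℝ) / K) =
      ((m + 1 : ℕ) : ℝ) / K := by
    simp only [smul_eq_mul]
    push_cast
    ring
  rw [e] at hc
  simp only [smul_eq_mul] at hc
  unfold step gradedMesh
  simp only [show m + 2 - 1 = m + 1 from rfl, Nat.add_sub_cancel]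
  nlinarith

theorem one_le_of_root_le {η ρ : ℝ} (hη : 0 < η) (hroot : 1 - 3 * η ^ 2 * (1 + η) = 0)
    (h : η ≤ ρ) : 1 ≤ 3 * ρ ^ 2 * (1 + ρ) := by
  have : 3 * η ^ 2 * (1 + η) ≤ 3 * ρ ^ 2 * (1 + ρ) := by gcongr
  linarith

end Mesh

/-! ### Vector-valued Taylor bounds from the mean value inequality, without the sharp factorial
constants. -/

section Taylor

variable {E : Type*} [NormedAddCommGroup E] [NormedSpace ℝ E] {v v1 v2 v3 : ℝ → E} {S : Set ℝ}
  {M p s : ℝ}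

theorem norm_taylor_one_le (h0 : ∀ y ∈ S, HasDerivWithinAt v (v1 y) S y)
    (h1 : ∀ y ∈ S, HasDerivWithinAt v1 (v2 y) S y) (hM : ∀ y ∈ S, ‖v2 y‖ ≤ M)
    (hsub : Set.uIcc p s ⊆ S) :
    ‖v s - v p - (s - p) • v1 p‖ ≤ M * |s - p| ^ 2 := by
  have hps : p ∈ Set.uIcc p s := Set.left_mem_uIcc
  have hss : s ∈ Set.uIcc p s := Set.right_mem_uIcc
  have hM0 : 0 ≤ M := (norm_nonneg _).trans (hM p (hsub hps))
  have hb : ∀ y ∈ Set.uIcc p s, ‖v1 y - v1 p‖ ≤ M * |s - p| := by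
    intro y hy
    have := (convex_uIcc p s).norm_image_sub_le_of_norm_hasDerivWithin_le
      (fun z hz => (h1 z (hsub hz)).mono hsub) (fun z hz => hM z (hsub hz)) hps hy
    refine this.trans ?_
    rw [Real.norm_eq_abs]
    exact mul_le_mul_of_nonneg_left (Set.abs_sub_left_of_mem_uIcc hy) hM0
  have hd : ∀ y ∈ Set.uIcc p s, HasDerivWithinAt (fun y => v y - (y - p) • v1 p) (v1 y - v1 p)
      (Set.uIcc p s) y := by
    intro y hy
    have e := ((hasDerivAt_id y).sub_const p).smul_const (v1 p)
    have := ((h0 y (hsub hy)).mono hsub).sub e.hasDerivWithinAt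
    rw [one_smul] at this
    exact this
  have := (convex_uIcc p s).norm_image_sub_le_of_norm_hasDerivWithin_le hd hb hps hss
  simp only [sub_self, zero_smul, sub_zero] at this
  rw [sub_right_comm]
  refine this.trans (le_of_eq ?_)
  rw [Real.norm_eq_abs]
  ring

theorem norm_taylor_two_le (h0 : ∀ y ∈ S, HasDerivWithinAt v (v1 y) S y)
    (h1 : ∀ y ∈ S, HasDerivWithinAt v1 (v2 y) S y)
    (h2 : ∀ y ∈ S, HasDerivWithinAt v2 (v3 y) S y) (hM : ∀ y ∈ S, ‖v3 y‖ ≤ M)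
    (hsub : Set.uIcc p s ⊆ S) :
    ‖v s - v p - (s - p) • v1 p - ((s - p) ^ 2 / 2) • v2 p‖ ≤ M * |s - p| ^ 3 := by
  have hps : p ∈ Set.uIcc p s := Set.left_mem_uIcc
  have hss : s ∈ Set.uIcc p s := Set.right_mem_uIcc
  have hM0 : 0 ≤ M := (norm_nonneg _).trans (hM p (hsub hps))
  have hb : ∀ y ∈ Set.uIcc p s, ‖v1 y - v1 p - (y - p) • v2 p‖ ≤ M * |s - p| ^ 2 := by
    intro y hy
    refine (norm_taylor_one_le h1 h2 hM ((Set.uIcc_subset_uIcc_left hy).trans hsub)).trans ?_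
    exact mul_le_mul_of_nonneg_left
      (pow_le_pow_left₀ (abs_nonneg _) (Set.abs_sub_left_of_mem_uIcc hy) 2) hM0
  have hd : ∀ y ∈ Set.uIcc p s, HasDerivWithinAt
      (fun y => v y - (y - p) • v1 p - ((y - p) ^ 2 / 2) • v2 p)
      (v1 y - v1 p - (y - p) • v2 p) (Set.uIcc p s) y := by
    intro y hy
    have e := ((hasDerivAt_id y).sub_const p).smul_const (v1 p)
    have e2 := ((((hasDerivAt_id y).sub_const p).pow 2).div_const 2).smul_const (v2 p)
    have := (((h0 y (hsub hy)).mono hsub).sub e.hasDerivWithinAt).sub e2.hasDerivWithinAt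
    rw [one_smul, id, show ((2 : ℕ) : ℝ) * (y - p) ^ (2 - 1) * 1 / 2 = y - p by norm_num] at this
    exact this
  have := (convex_uIcc p s).norm_image_sub_le_of_norm_hasDerivWithin_le hd hb hps hss
  simp only [sub_self, zero_smul, sub_zero, ne_eq, OfNat.ofNat_ne_zero, not_false_eq_true,
    zero_pow, zero_div] at this
  have e : v s - v p - (s - p) • v1 p - ((s - p) ^ 2 / 2) • v2 p =
    v s - (s - p) • v1 p - ((s - p) ^ 2 / 2) • v2 p - v p := by abel
  rw [e]
  refine this.trans (le_of_eq ?_)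
  rw [Real.norm_eq_abs]
  ring

end Taylor

/-! ### Local quadrature errors of the quadratic and linear rules. -/

section LocalError

variable {E : Type*} [NormedAddCommGroup E] [NormedSpace ℝ E] [CompleteSpace E]
  {v v1 v2 v3 : ℝ → E} {W : ℝ → ℝ} {a b c x κ M : ℝ}

/-- The local error of the product quadratic interpolation rule on `[a, b]`. -/
theorem norm_quadratic_rule_sub_le (hab : a < b) (hbc : b < c)
    (h0 : ∀ y ∈ Set.Icc a c, HasDerivWithinAt v (v1 y) (Set.Icc a c) y)
    (h1 : ∀ y ∈ Set.Icc a c, HasDerivWithinAt v1 (v2 y) (Set.Icc a c) y)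
    (h2 : ∀ y ∈ Set.Icc a c, HasDerivWithinAt v2 (v3 y) (Set.Icc a c) y)
    (hM : ∀ y ∈ Set.Icc a c, ‖v3 y‖ ≤ M)
    (hW : ContinuousOn W (Set.Icc a b)) (hmono : MonotoneOn W (Set.Icc a b)) :
    ‖(∫ s in a..b, W s • v1 s) -
      ((∫ s in a..b, (2 * s - b - c) / ((b - a) * ((b - a) + (c - b))) * W s) • v a +
      (-∫ s in a..b, (2 * s - a - c) / ((b - a) * (c - b)) * W s) • v b +
      (∫ s in a..b, (2 * s - a - b) / ((c - b) * ((b - a) + (c - b))) * W s) • v c)‖ ≤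
    (W b - W a) * ((b - a) * (M * (3 * (b - a) ^ 2 + (c - b) ^ 2))) := by
  have hab' : 0 < b - a := sub_pos.2 hab
  have hbc' : 0 < c - b := sub_pos.2 hbc
  have hac' : 0 < b - a + (c - b) := by linarith
  have haS : a ∈ Set.Icc a c := ⟨le_rfl, by linarith⟩
  have hbS : b ∈ Set.Icc a c := ⟨by linarith, by linarith⟩
  have hcS : c ∈ Set.Icc a c := ⟨by linarith, le_rfl⟩
  have hM0 : 0 ≤ M := (norm_nonneg _).trans (hM a haS)
  have hsubset : Set.Icc a b ⊆ Set.Icc a c := Set.Icc_subset_Icc_right hbc.le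
  have hv1 : ContinuousOn v1 (Set.Icc a b) := fun y hy =>
    ((h1 y (hsubset hy)).continuousWithinAt).mono hsubset
  have huIcc : Set.uIcc a b = Set.Icc a b := Set.uIcc_of_le hab.le
  set A : ℝ → ℝ := fun s => (2 * s - b - c) / ((b - a) * ((b - a) + (c - b))) with hA
  set Bq : ℝ → ℝ := fun s => (2 * s - a - c) / ((b - a) * (c - b)) with hB
  set C : ℝ → ℝ := fun s => (2 * s - a - b) / ((c - b) * ((b - a) + (c - b))) with hC
  have cA : Continuous A := by fun_prop
  have cB : Continuous Bq := by fun_prop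
  have cC : Continuous C := by fun_prop
  set g : ℝ → E := fun s => v1 s - A s • v a + Bq s • v b - C s • v c with hg
  have hgc : ContinuousOn g (Set.Icc a b) := by fun_prop
  have I : ∀ f : ℝ → E, ContinuousOn f (Set.Icc a b) → IntervalIntegrable f volume a b := by
    intro f hf
    apply ContinuousOn.intervalIntegrable
    rwa [huIcc]
  have hint : (∫ s in a..b, W s • v1 s) -
      ((∫ s in a..b, A s * W s) • v a + (-∫ s in a..b, Bq s * W s) • v b +
      (∫ s in a..b, C s * W s) • v c) = ∫ s in a..b, W s • g s := by
    rw [neg_smul, ← intervalIntegral.integral_smul_const, ← intervalIntegral.integral_smul_const,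
      ← intervalIntegral.integral_smul_const, ← sub_eq_add_neg, ← intervalIntegral.integral_sub,
      ← intervalIntegral.integral_add, ← intervalIntegral.integral_sub]
    · congr 1
      funext s
      simp only [hg]
      module
    all_goals
      apply I
      fun_prop
  have hv : ∫ s in a..b, v1 s = v b - v a := by
    apply intervalIntegral.integral_eq_sub_of_hasDerivAt_of_le hab.le
    · exact fun y hy => ((h0 y (hsubset hy)).continuousWithinAt).mono hsubset
    · intro y hy
      exact (h0 y ⟨hy.1.le, by linarith [hy.2]⟩).hasDerivAt
        (Icc_mem_nhds hy.1 (by linarith [hy.2]))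
    · exact I _ hv1
  have IR : ∀ f : ℝ → ℝ, Continuous f → IntervalIntegrable f volume a b :=
    fun f hf => hf.intervalIntegrable _ _
  have hlin : ∀ d e m : ℝ, ∫ s in a..b, (2 * s - d - e) / m = (b - a) * (a + b - d - e) / m := by
    intro d e m
    rw [intervalIntegral.integral_div, intervalIntegral.integral_sub,
      intervalIntegral.integral_sub, intervalIntegral.integral_const_mul, integral_id,
      intervalIntegral.integral_const, intervalIntegral.integral_const]
    · simp only [smul_eq_mul]
      ring
    all_goals exact IR _ (by fun_prop)
  -- The interpolant agrees with `v` at `a` and `b`, so its derivative has the same integral as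
  -- `v1`.
  have hg0 : ∫ s in a..b, g s = 0 := by
    simp only [hg]
    rw [intervalIntegral.integral_sub, intervalIntegral.integral_add,
      intervalIntegral.integral_sub, intervalIntegral.integral_smul_const,
      intervalIntegral.integral_smul_const, intervalIntegral.integral_smul_const, hv, hlin, hlin,
      hlin]
    · have e1 : (b - a) * (a + b - b - c) / ((b - a) * (b - a + (c - b))) = -1 := by
        field_simp
        ring
      have e2 : (b - a) * (a + b - a - c) / ((b - a) * (c - b)) = -1 := by
        field_simp
        ring
      have e3 : (b - a) * (a + b - a - b) / ((c - b) * (b - a + (c - b))) = 0 := by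
        ring
      rw [e1, e2, e3]
      module
    all_goals
      apply I
      fun_prop
  -- Quadratic interpolation is exact on quadratics (`eB`, `e1`, `e2`), so only the Taylor
  -- remainders at `b` survive in `g`.
  have hgb : ∀ s ∈ Set.Icc a b, ‖g s‖ ≤ M * (3 * (b - a) ^ 2 + (c - b) ^ 2) := by
    intro s hs
    have r1 := norm_taylor_one_le (p := b) (s := s) h1 h2 hM
      (Set.uIcc_subset_Icc hbS (hsubset hs))
    have ra := norm_taylor_two_le (p := b) (s := a) h0 h1 h2 hM (Set.uIcc_subset_Icc hbS haS)
    have rc := norm_taylor_two_le (p := b) (s := c) h0 h1 h2 hM (Set.uIcc_subset_Icc hbS hcS)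
    set Ra := v a - v b - (a - b) • v1 b - ((a - b) ^ 2 / 2) • v2 b with hRa
    set Rc := v c - v b - (c - b) • v1 b - ((c - b) ^ 2 / 2) • v2 b with hRc
    set R1 := v1 s - v1 b - (s - b) • v2 b with hR1
    have e : g s = R1 - A s • Ra - C s • Rc := by
      have eB : Bq s = A s + C s := by
        simp only [hA, hB, hC]
        field_simp
        ring
      have e1 : A s * (a - b) + C s * (c - b) = 1 := by
        simp only [hA, hC]
        field_simp
        ring
      have e2 : A s * ((a - b) ^ 2 / 2) + C s * ((c - b) ^ 2 / 2) = s - b := by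
        simp only [hA, hC]
        field_simp
        ring
      have : R1 - A s • Ra - C s • Rc = v1 s - A s • v a + (A s + C s) • v b - C s • v c +
        (A s * (a - b) + C s * (c - b) - 1) • v1 b +
        (A s * ((a - b) ^ 2 / 2) + C s * ((c - b) ^ 2 / 2) - (s - b)) • v2 b := by
        rw [hRa, hRc, hR1]
        module
      rw [this, e1, e2, sub_self, sub_self, zero_smul, zero_smul, add_zero, add_zero, ← eB]
    have hAb : |A s| ≤ 2 / (b - a) := by
      simp only [hA]
      rw [abs_div, abs_of_pos (mul_pos hab' hac'), div_le_div_iff₀ (mul_pos hab' hac') hab']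
      have : |2 * s - b - c| ≤ 2 * (b - a + (c - b)) := by
        rw [abs_le]
        constructor <;> linarith [hs.1, hs.2]
      nlinarith
    have hCb : |C s| ≤ 1 / (c - b) := by
      simp only [hC]
      rw [abs_div, abs_of_pos (mul_pos hbc' hac'), div_le_div_iff₀ (mul_pos hbc' hac') hbc']
      have : |2 * s - a - b| ≤ (b - a + (c - b)) := by
        rw [abs_le]
        constructor <;> linarith [hs.1, hs.2]
      nlinarith
    rw [abs_sub_comm, abs_of_pos hab'] at ra
    rw [abs_of_pos hbc'] at rc
    have hs1 : |s - b| ≤ b - a := by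
      rw [abs_le]
      constructor <;> linarith [hs.1, hs.2]
    have r1' : ‖R1‖ ≤ M * (b - a) ^ 2 := by
      refine r1.trans ?_
      gcongr
    rw [e]
    calc ‖R1 - A s • Ra - C s • Rc‖ ≤ ‖R1‖ + |A s| * ‖Ra‖ + |C s| * ‖Rc‖ := by
          refine (norm_sub_le _ _).trans ?_
          rw [norm_smul (C s), Real.norm_eq_abs]
          gcongr
          refine (norm_sub_le _ _).trans ?_
          rw [norm_smul, Real.norm_eq_abs]
      _ ≤ M * (b - a) ^ 2 + 2 / (b - a) * (M * (b - a) ^ 3) + 1 / (c - b) * (M * (c - b) ^ 3) := by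
          gcongr
      _ = _ := by
          field_simp
          ring
  -- Since `g` has mean zero, `W` may be replaced by `W - W b`. This gains the kernel increment over
  -- the interval in place of the kernel itself.
  have hWb : ∫ s in a..b, W b • g s = 0 := by
    rw [intervalIntegral.integral_smul, hg0, smul_zero]
  have hfin : ∫ s in a..b, W s • g s = ∫ s in a..b, (W s - W b) • g s := by
    simp only [sub_smul]
    rw [intervalIntegral.integral_sub, hWb, sub_zero]
    all_goals
      apply I
      fun_prop
  rw [hint, hfin]
  have := intervalIntegral.norm_integral_le_of_norm_le_const (a := a) (b := b)
    (f := fun s => (W s - W b) • g s)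
    (C := (W b - W a) * (M * (3 * (b - a) ^ 2 + (c - b) ^ 2))) (by
      intro s hs
      rw [Set.uIoc_of_le hab.le] at hs
      have hs' : s ∈ Set.Icc a b := Set.Ioc_subset_Icc_self hs
      rw [norm_smul, Real.norm_eq_abs, abs_sub_comm,
        abs_of_nonneg (sub_nonneg.2 (hmono hs' ⟨hab.le, le_rfl⟩ hs'.2))]
      have h3 := hmono ⟨le_rfl, hab.le⟩ hs' hs'.1
      have h4 := hmono hs' ⟨hab.le, le_rfl⟩ hs'.2
      have h5 := hgb s hs'
      have h6 := norm_nonneg (g s)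
      apply mul_le_mul _ h5 h6 <;> linarith)
  rw [abs_of_pos hab'] at this
  linarith

/-- The local error of the product linear interpolation rule for a weight that is orthogonal to
`s - (a + b) / 2`. -/
theorem norm_linear_rule_sub_le (hab : a < b) (hax : a < x) (hxb : x ≤ b)
    (h0 : ∀ y ∈ Set.Icc a b, HasDerivWithinAt v (v1 y) (Set.Icc a b) y)
    (h1 : ∀ y ∈ Set.Icc a b, HasDerivWithinAt v1 (v2 y) (Set.Icc a b) y)
    (h2 : ∀ y ∈ Set.Icc a b, HasDerivWithinAt v2 (v3 y) (Set.Icc a b) y)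
    (hM : ∀ y ∈ Set.Icc a b, ‖v3 y‖ ≤ M)
    (hW : IntervalIntegrable W volume a x) (hW0 : ∀ s ∈ Set.Ioc a x, 0 ≤ W s)
    (hκ : ∫ s in a..x, W s = κ * (b - a)) (horth : ∫ s in a..x, W s * (s - (a + b) / 2) = 0) :
    ‖(∫ s in a..x, W s • v1 s) - κ • (v b - v a)‖ ≤
      κ * (b - a) * (2 * M * (b - a) ^ 2) := by
  have hab' : 0 < b - a := sub_pos.2 hab
  have haS : a ∈ Set.Icc a b := ⟨le_rfl, hab.le⟩
  have hbS : b ∈ Set.Icc a b := ⟨hab.le, le_rfl⟩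
  have hM0 : 0 ≤ M := (norm_nonneg _).trans (hM a haS)
  have hsubset : Set.Icc a x ⊆ Set.Icc a b := Set.Icc_subset_Icc_right hxb
  have hv1 : ContinuousOn v1 (Set.uIcc a x) := by
    rw [Set.uIcc_of_le hax.le]
    exact fun y hy => ((h1 y (hsubset hy)).continuousWithinAt).mono hsubset
  set q : E := (b - a)⁻¹ • (v b - v a) with hq
  -- The term with `v2 a` is free by orthogonality of the weight, and removing it raises the
  -- accuracy by one order: `g` reduces to Taylor remainders at `a`.
  set g : ℝ → E := fun s => v1 s - q - (s - (a + b) / 2) • v2 a with hg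
  have hint : (∫ s in a..x, W s • v1 s) - κ • (v b - v a) = ∫ s in a..x, W s • g s := by
    have e1 : κ • (v b - v a) = ∫ s in a..x, W s • q := by
      rw [intervalIntegral.integral_smul_const, hκ, hq, smul_smul]
      congr 1
      field_simp
    have e2 : ∫ s in a..x, (W s * (s - (a + b) / 2)) • v2 a = 0 := by
      rw [intervalIntegral.integral_smul_const, horth, zero_smul]
    rw [e1, ← sub_zero (_ - _), ← e2, ← intervalIntegral.integral_sub,
      ← intervalIntegral.integral_sub]
    · congr 1
      funext s
      simp only [hg]
      module
    · exact (hW.smul_continuousOn hv1).sub (hW.smul_continuousOn (by fun_prop))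
    · exact (hW.mul_continuousOn (by fun_prop)).smul_continuousOn (by fun_prop)
    · exact hW.smul_continuousOn hv1
    · exact hW.smul_continuousOn (by fun_prop)
  have hgb : ∀ s ∈ Set.Icc a x, ‖g s‖ ≤ 2 * M * (b - a) ^ 2 := by
    intro s hs
    have r1 := norm_taylor_one_le (p := a) (s := s) h1 h2 hM
      (Set.uIcc_subset_Icc haS (hsubset hs))
    have rb := norm_taylor_two_le (p := a) (s := b) h0 h1 h2 hM (Set.uIcc_subset_Icc haS hbS)
    set Rb := v b - v a - (b - a) • v1 a - ((b - a) ^ 2 / 2) • v2 a with hRb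
    set R1 := v1 s - v1 a - (s - a) • v2 a with hR1
    have e : g s = R1 - (b - a)⁻¹ • Rb := by
      simp only [hg, hq, hRb, hR1]
      match_scalars <;> field_simp <;> ring
    rw [abs_of_pos hab'] at rb
    have hs1 : |s - a| ≤ b - a := by
      rw [abs_le]
      constructor <;> linarith [hs.1, hs.2]
    rw [e]
    calc ‖R1 - (b - a)⁻¹ • Rb‖ ≤ ‖R1‖ + (b - a)⁻¹ * ‖Rb‖ := by
          refine (norm_sub_le _ _).trans ?_
          rw [norm_smul, Real.norm_eq_abs, abs_of_pos (inv_pos.2 hab')]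
      _ ≤ M * (b - a) ^ 2 + (b - a)⁻¹ * (M * (b - a) ^ 3) := by
          gcongr
          refine r1.trans ?_
          gcongr
      _ = _ := by
          field_simp
          ring
  rw [hint, ← hκ, ← intervalIntegral.integral_mul_const]
  apply intervalIntegral.norm_integral_le_of_norm_le hax.le
  · refine Eventually.of_forall fun s hs => ?_
    rw [norm_smul, Real.norm_eq_abs, abs_of_nonneg (hW0 s hs)]
    exact mul_le_mul_of_nonneg_left (hgb s (Set.Ioc_subset_Icc_self hs)) (hW0 s hs)
  · exact hW.mul_const _

end LocalError

/-! ### Moments of the kernel. -/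

section KernelIntegrals

variable {α a x : ℝ}

theorem kernel_eq_rpow {s : ℝ} (hs : s ≤ x) : 1 / (x - s) ^ α = (x - s) ^ (-α) := by
  rw [Real.rpow_neg (by linarith), one_div]

theorem intervalIntegrable_kernel (hα1 : α < 1) (hax : a ≤ x) :
    IntervalIntegrable (fun s => 1 / (x - s) ^ α) volume a x := by
  have h := (intervalIntegral.intervalIntegrable_rpow' (a := x - a) (b := 0) (r := -α)
    (by linarith)).comp_sub_left x
  simp only [sub_sub_cancel, sub_zero] at h
  refine h.congr fun s hs => ?_
  rw [Set.uIoc_of_le hax] at hs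
  exact (kernel_eq_rpow hs.2).symm

theorem integral_kernel (hα1 : α < 1) (hax : a ≤ x) :
    ∫ s in a..x, 1 / (x - s) ^ α = (x - a) ^ (1 - α) / (1 - α) := by
  have e : ∫ s in a..x, 1 / (x - s) ^ α = ∫ s in a..x, (x - s) ^ (-α) := by
    apply intervalIntegral.integral_congr
    intro s hs
    rw [Set.uIcc_of_le hax] at hs
    exact kernel_eq_rpow hs.2
  rw [e, intervalIntegral.integral_comp_sub_left (fun y => y ^ (-α)), sub_self,
    integral_rpow (Or.inl (by linarith)), neg_add_eq_sub, Real.zero_rpow (by linarith), sub_zero]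

theorem integral_kernel_mul (hα1 : α < 1) (hax : a ≤ x) (m : ℝ) :
    ∫ s in a..x, 1 / (x - s) ^ α * (s - m) =
      (x - m) * ((x - a) ^ (1 - α) / (1 - α)) - (x - a) ^ (2 - α) / (2 - α) := by
  have e : ∫ s in a..x, 1 / (x - s) ^ α * (s - m) =
      ∫ s in a..x, ((x - m) * (x - s) ^ (-α) - (x - s) ^ (1 - α)) := by
    apply intervalIntegral.integral_congr
    intro s hs
    rw [Set.uIcc_of_le hax] at hs
    simp only
    rw [kernel_eq_rpow hs.2]
    rcases hs.2.eq_or_lt with rfl | h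
    · rcases eq_or_ne α 0 with rfl | h0
      · simp
      · rw [sub_self, Real.zero_rpow (neg_ne_zero.2 h0), Real.zero_rpow (by linarith)]
        simp
    · rw [show 1 - α = -α + 1 by ring, Real.rpow_add_one (by linarith)]
      ring
  rw [e, intervalIntegral.integral_comp_sub_left (fun y => (x - m) * y ^ (-α) - y ^ (1 - α)),
    sub_self, intervalIntegral.integral_sub, intervalIntegral.integral_const_mul,
    integral_rpow (Or.inl (by linarith)), integral_rpow (Or.inl (by linarith)), neg_add_eq_sub,
    Real.zero_rpow (by linarith), Real.zero_rpow (by linarith), sub_zero, sub_zero]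
  · rw [show (1 : ℝ) - α + 1 = 2 - α by ring]
  · exact (intervalIntegral.intervalIntegrable_rpow' (by linarith)).const_mul _
  · exact intervalIntegral.intervalIntegrable_rpow' (by linarith)

/-- This is the reason for `σ = 1 - α / 2`. With `h = b - a` and upper limit `x = a + σ h`,
vanishing means `(x - m) / (1 - α) = (x - a) / (2 - α)` at the midpoint `m`, and both quotients
equal `h / 2`. -/
theorem integral_kernel_mul_sub_midpoint {α : ℝ} (hα0 : 0 < α) (hα1 : α < 1) {a b : ℝ}
    (hab : a < b) :
    ∫ s in a..(a + (1 - α / 2) * (b - a)),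
      1 / (a + (1 - α / 2) * (b - a) - s) ^ α * (s - (a + b) / 2) = 0 := by
  have hσ : 0 < 1 - α / 2 := by linarith
  have hp : 0 < (1 - α / 2) * (b - a) := mul_pos hσ (by linarith)
  rw [integral_kernel_mul hα1 (by linarith), add_sub_cancel_left,
    show 2 - α = (1 - α) + 1 by ring, Real.rpow_add_one hp.ne']
  have h1 : 1 - α ≠ 0 := by linarith
  have h2 : 1 - α + 1 ≠ 0 := by linarith
  field_simp
  ring

end KernelIntegrals

/-! ### Functions with a weak singularity at time zero. -/

/-- `u` has three derivatives `v1, v2, v3` on `(0, T]`, which blow up at `0` like `t ^ (α - m)`. -/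
structure WeaklySingular {E : Type*} [NormedAddCommGroup E] [NormedSpace ℝ E]
    (α T B : ℝ) (u v1 v2 v3 : ℝ → E) : Prop where
  cont : ContinuousOn u (Set.Icc 0 T)
  d0 : ∀ s ∈ Set.Ioc 0 T, HasDerivWithinAt u (v1 s) (Set.Ioc 0 T) s
  d1 : ∀ s ∈ Set.Ioc 0 T, HasDerivWithinAt v1 (v2 s) (Set.Ioc 0 T) s
  d2 : ∀ s ∈ Set.Ioc 0 T, HasDerivWithinAt v2 (v3 s) (Set.Ioc 0 T) s
  b1 : ∀ s ∈ Set.Ioc 0 T, ‖v1 s‖ ≤ B * s ^ (α - 1)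
  b2 : ∀ s ∈ Set.Ioc 0 T, ‖v2 s‖ ≤ B * s ^ (α - 2)
  b3 : ∀ s ∈ Set.Ioc 0 T, ‖v3 s‖ ≤ B * s ^ (α - 3)

namespace WeaklySingular

variable {E : Type*} [NormedAddCommGroup E] [NormedSpace ℝ E]
  {α T B : ℝ} {u v1 v2 v3 : ℝ → E}

theorem nonneg (h : WeaklySingular α T B u v1 v2 v3) (hT : 0 < T) : 0 ≤ B := by
  have := (norm_nonneg _).trans (h.b1 T ⟨hT, le_rfl⟩)
  exact nonneg_of_mul_nonneg_left this (by positivity)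

theorem continuousOn_deriv (h : WeaklySingular α T B u v1 v2 v3) :
    ContinuousOn v1 (Set.Ioc 0 T) := fun s hs => (h.d1 s hs).continuousWithinAt

theorem intervalIntegrable_bound (hα0 : 0 < α) (a b : ℝ) :
    IntervalIntegrable (fun s : ℝ => B * s ^ (α - 1)) volume a b :=
  (intervalIntegral.intervalIntegrable_rpow' (by linarith)).const_mul _

theorem intervalIntegrable_deriv (h : WeaklySingular α T B u v1 v2 v3) (hα0 : 0 < α)
    {a b : ℝ} (ha : 0 ≤ a) (hab : a ≤ b) (hb : b ≤ T) :
    IntervalIntegrable v1 volume a b := by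
  have hsub : Set.Ioc a b ⊆ Set.Ioc 0 T := Set.Ioc_subset_Ioc ha hb
  rw [intervalIntegrable_iff_integrableOn_Ioc_of_le hab]
  have hg := (intervalIntegrable_iff_integrableOn_Ioc_of_le hab).1
    (intervalIntegrable_bound (B := B) hα0 a b)
  refine Integrable.mono' hg
    ((h.continuousOn_deriv.mono hsub).aestronglyMeasurable measurableSet_Ioc) ?_
  filter_upwards [ae_restrict_mem measurableSet_Ioc] with s hs
  exact h.b1 s (hsub hs)

theorem norm_sub_le [CompleteSpace E] (h : WeaklySingular α T B u v1 v2 v3) (hα0 : 0 < α)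
    {a b : ℝ} (ha : 0 ≤ a) (hab : a ≤ b) (hb : b ≤ T) : ‖u b - u a‖ ≤ B / α * b ^ α := by
  rcases hab.eq_or_lt with rfl | hab'
  · simp only [sub_self, norm_zero]
    rcases ha.eq_or_lt with rfl | ha'
    · simp [Real.zero_rpow hα0.ne']
    · have := h.nonneg (ha'.trans_le hb)
      positivity
  have hT : 0 < T := (ha.trans_lt hab').trans_le hb
  have hB := h.nonneg hT
  have hftc : ∫ s in a..b, v1 s = u b - u a := by
    apply intervalIntegral.integral_eq_sub_of_hasDerivAt_of_le hab
    · exact h.cont.mono (Set.Icc_subset_Icc ha hb)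
    · intro s hs
      have h1 : 0 < s := ha.trans_lt hs.1
      have h2 : s < T := hs.2.trans_le hb
      exact (h.d0 s ⟨h1, h2.le⟩).hasDerivAt (Ioc_mem_nhds h1 h2)
    · exact h.intervalIntegrable_deriv hα0 ha hab hb
  rw [← hftc]
  have := intervalIntegral.norm_integral_le_of_norm_le hab (f := v1)
    (g := fun s => B * s ^ (α - 1)) (μ := volume)
    (Eventually.of_forall fun s hs => h.b1 s ⟨ha.trans_lt hs.1, hs.2.trans hb⟩)
    (intervalIntegrable_bound hα0 a b)
  refine this.trans ?_
  rw [intervalIntegral.integral_const_mul, integral_rpow (Or.inl (by linarith)), sub_add_cancel,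
    div_mul_eq_mul_div, mul_div_assoc]
  have : 0 ≤ a ^ α := by positivity
  gcongr
  linarith

theorem norm_integral_smul_le (h : WeaklySingular α T B u v1 v2 v3) (hα0 : 0 < α)
    {W : ℝ → ℝ} {b C : ℝ} (hb0 : 0 < b) (hb : b ≤ T) (hW0 : ∀ s ∈ Set.Ioc 0 b, 0 ≤ W s)
    (hWC : ∀ s ∈ Set.Ioc 0 b, W s ≤ C) :
    ‖∫ s in (0 : ℝ)..b, W s • v1 s‖ ≤ C * (B / α * b ^ α) := by
  have hB := h.nonneg (hb0.trans_le hb)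
  have := intervalIntegral.norm_integral_le_of_norm_le hb0.le (f := fun s => W s • v1 s)
    (g := fun s => C * (B * s ^ (α - 1))) (μ := volume)
    (Eventually.of_forall fun s hs => by
      rw [norm_smul, Real.norm_eq_abs, abs_of_nonneg (hW0 s hs)]
      have h1 := h.b1 s ⟨hs.1, hs.2.trans hb⟩
      exact mul_le_mul (hWC s hs) h1 (norm_nonneg _) ((hW0 s hs).trans (hWC s hs)))
    ((intervalIntegrable_bound hα0 0 b).const_mul _)
  refine this.trans (le_of_eq ?_)
  rw [intervalIntegral.integral_const_mul, intervalIntegral.integral_const_mul,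
    integral_rpow (Or.inl (by linarith)), sub_add_cancel, Real.zero_rpow hα0.ne']
  ring

/-- The derivative is singular at `0` and the kernel at `x`. Each half of `[0, x]` contains just one
of the two singularities. -/
theorem intervalIntegrable_kernel_smul (h : WeaklySingular α T B u v1 v2 v3) (hα0 : 0 < α)
    (hα1 : α < 1) {x a b : ℝ} (ha : 0 ≤ a) (hab : a ≤ b) (hbx : b ≤ x) (hx : x ≤ T) :
    IntervalIntegrable (fun s => (1 / (x - s) ^ α) • v1 s) volume a b := by
  rcases hab.eq_or_lt with rfl | hab'
  · simp
  have hx0 : 0 < x := by linarith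
  have h1 : IntervalIntegrable (fun s => (1 / (x - s) ^ α) • v1 s) volume 0 (x / 2) := by
    apply (h.intervalIntegrable_deriv hα0 le_rfl (by linarith) (by linarith)).continuousOn_smul
    rw [Set.uIcc_of_le (by linarith)]
    exact continuousOn_kernel (by linarith)
  have h2 : IntervalIntegrable (fun s => (1 / (x - s) ^ α) • v1 s) volume (x / 2) x := by
    apply (intervalIntegrable_kernel hα1 (by linarith)).smul_continuousOn
    rw [Set.uIcc_of_le (by linarith)]
    exact h.continuousOn_deriv.mono fun s hs => ⟨by linarith [hs.1], hs.2.trans hx⟩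
  refine (h1.trans h2).mono_set ?_
  rw [Set.uIcc_of_le hab, Set.uIcc_of_le hx0.le]
  exact Set.Icc_subset_Icc ha hbx

theorem caputo_eq (h : WeaklySingular α T B u v1 v2 v3) {x : ℝ} (hx0 : 0 ≤ x) (hx : x < T) :
    caputo α u x = (Real.Gamma (1 - α))⁻¹ • ∫ s in (0 : ℝ)..x, (1 / (x - s) ^ α) • v1 s := by
  unfold caputo
  congr 1
  apply intervalIntegral.integral_congr_uIoo
  intro s hs
  rw [Set.uIoo_of_le hx0] at hs
  have h2 : s < T := hs.2.trans hx
  simp only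
  rw [kernel_eq_rpow hs.2.le, ((h.d0 s ⟨hs.1, h2.le⟩).hasDerivAt (Ioc_mem_nhds hs.1 h2)).deriv]

theorem norm_third_le (h : WeaklySingular α T B u v1 v2 v3) (hα1 : α < 1) {a s : ℝ} (ha : 0 < a)
    (has : a ≤ s) (hs : s ≤ T) : ‖v3 s‖ ≤ B * a ^ (α - 3) := by
  have hB := h.nonneg ((ha.trans_le has).trans_le hs)
  refine (h.b3 s ⟨ha.trans_le has, hs⟩).trans ?_
  have := Real.rpow_le_rpow_of_nonpos ha has (z := α - 3) (by linarith)
  gcongr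

theorem norm_second_le (h : WeaklySingular α T B u v1 v2 v3) (hα1 : α < 1) {a s : ℝ} (ha : 0 < a)
    (has : a ≤ s) (hs : s ≤ T) : ‖v2 s‖ ≤ B * a ^ (α - 2) := by
  have hB := h.nonneg ((ha.trans_le has).trans_le hs)
  refine (h.b2 s ⟨ha.trans_le has, hs⟩).trans ?_
  have := Real.rpow_le_rpow_of_nonpos ha has (z := α - 2) (by linarith)
  gcongr

/-- The Caputo integral over the first step. -/
theorem norm_first_integral_le [CompleteSpace E] (h : WeaklySingular α T B u v1 v2 v3)
    (hα0 : 0 < α) (hα1 : α < 1) {x : ℝ} (hx0 : 0 < x) (hx : x ≤ T) :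
    ‖∫ s in (0 : ℝ)..x, (1 / (x - s) ^ α) • v1 s‖ ≤ B / α + B / (1 - α) := by
  have hB := h.nonneg (hx0.trans_le hx)
  have hx2 : 0 < x / 2 := by linarith
  -- Split at `x / 2`: the kernel is largest there on the left half, the derivative bound on the
  -- right half. The powers of `x` cancel in both pieces.
  rw [← intervalIntegral.integral_add_adjacent_intervals
    (h.intervalIntegrable_kernel_smul hα0 hα1 le_rfl hx2.le (by linarith) hx)
    (h.intervalIntegrable_kernel_smul hα0 hα1 hx2.le (by linarith) le_rfl hx)]
  refine (norm_add_le _ _).trans (add_le_add ?_ ?_)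
  · refine (h.norm_integral_smul_le hα0 (C := 1 / (x - x / 2) ^ α) hx2 (by linarith) ?_ ?_).trans ?_
    · exact fun s hs => (kernel_pos (by linarith [hs.2])).le
    · exact fun s hs => kernel_mono hα0 (by linarith) hs.2
    · rw [sub_half]
      apply le_of_eq
      have : 0 < (x / 2) ^ α := by positivity
      field_simp
  · have := intervalIntegral.norm_integral_le_of_norm_le (a := x / 2) (b := x) (by linarith)
      (f := fun s => (1 / (x - s) ^ α) • v1 s)
      (g := fun s => 1 / (x - s) ^ α * (B * (x / 2) ^ (α - 1))) (μ := volume)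
      (Eventually.of_forall fun s hs => by
        have h0 : 0 ≤ 1 / (x - s) ^ α := by
          have : 0 ≤ x - s := by linarith [hs.2]
          positivity
        rw [norm_smul, Real.norm_eq_abs, abs_of_nonneg h0]
        have h1 := h.b1 s ⟨by linarith [hs.1], hs.2.trans hx⟩
        have h2 := Real.rpow_le_rpow_of_nonpos hx2 hs.1.le (z := α - 1) (by linarith)
        gcongr
        exact h1.trans (by gcongr))
      ((intervalIntegrable_kernel hα1 (by linarith)).mul_const _)
    refine this.trans (le_of_eq ?_)
    rw [intervalIntegral.integral_mul_const, integral_kernel hα1 (by linarith), sub_half]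
    have e : (x / 2) ^ (1 - α) * (x / 2) ^ (α - 1) = 1 := by
      rw [← Real.rpow_add hx2]
      simp
    calc _ = (x / 2) ^ (1 - α) * (x / 2) ^ (α - 1) * (B / (1 - α)) := by ring
      _ = _ := by rw [e, one_mul]

end WeaklySingular

/-! ### Decomposition of the truncation error into interval contributions. -/

section Truncation

variable {E : Type*} [NormedAddCommGroup E] [NormedSpace ℝ E]
  {α T B r : ℝ} {K : ℕ} {u v1 v2 v3 : ℝ → E}

/-- The error of the quadratic rule on the `(i+1)`-st interval, for the kernel of the node
`t_{n+1}^*`. -/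
noncomputable def quadraticError (α : ℝ) (t : ℕ → ℝ) (u v1 : ℝ → E) (n i : ℕ) : E :=
  (∫ s in t i..t (i + 1), (1 / (node α t (n + 1) - s) ^ α) • v1 s) -
    (coeffA α t (n + 1) (i + 1) • u (t i) + coeffB α t (n + 1) (i + 1) • u (t (i + 1)) +
      coeffC α t (n + 1) (i + 1) • u (t (i + 2)))

/-- The error of the linear rule on the last interval, for the kernel of the node `t_{n+1}^*`. -/
noncomputable def linearError (α : ℝ) (t : ℕ → ℝ) (u v1 : ℝ → E) (n : ℕ) : E :=
  (∫ s in t n..node α t (n + 1), (1 / (node α t (n + 1) - s) ^ α) • v1 s) -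
    ((1 - α / 2) ^ (1 - α) / ((1 - α) * step t (n + 1) ^ α)) • (u (t (n + 1)) - u (t n))

theorem caputo_sub_opL (h : WeaklySingular α T B u v1 v2 v3) (hα0 : 0 < α) (hα1 : α < 1)
    {t : ℕ → ℝ} (ht : StrictMono t) (ht0 : t 0 = 0) {n : ℕ} (hn : t (n + 1) ≤ T) :
    caputo α u (node α t (n + 1)) - opL α t (fun k => u (t k)) (n + 1) =
      (Real.Gamma (1 - α))⁻¹ •
        (∑ i ∈ Finset.range n, quadraticError α t u v1 n i + linearError α t u v1 n) := by
  have hx : node α t (n + 1) < T := by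
    have h2 := step_pos ht (Nat.le_add_left 1 n)
    have h3 : step t (n + 1) = t (n + 1) - t n := rfl
    rw [node_succ]
    nlinarith
  have htn : ∀ k, 0 ≤ t k := fun k => ht0 ▸ ht.monotone (Nat.zero_le k)
  have hlt := fun {j : ℕ} (hj : j ≤ n) => lt_node hα1 ht hj
  rw [h.caputo_eq ((htn n).trans (hlt le_rfl).le) hx]
  have hint : ∫ s in (0 : ℝ)..node α t (n + 1), (1 / (node α t (n + 1) - s) ^ α) • v1 s =
      ∑ i ∈ Finset.range n, (∫ s in t i..t (i + 1), (1 / (node α t (n + 1) - s) ^ α) • v1 s) +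
        ∫ s in t n..node α t (n + 1), (1 / (node α t (n + 1) - s) ^ α) • v1 s := by
    rw [intervalIntegral.sum_integral_adjacent_intervals, ht0,
      intervalIntegral.integral_add_adjacent_intervals]
    · exact h.intervalIntegrable_kernel_smul hα0 hα1 le_rfl (htn n) (hlt le_rfl).le hx.le
    · exact h.intervalIntegrable_kernel_smul hα0 hα1 (htn n) (hlt le_rfl).le le_rfl hx.le
    · intro i hi
      exact h.intervalIntegrable_kernel_smul hα0 hα1 (htn i) (ht.monotone (Nat.le_succ i))
        (hlt hi).le hx.le
  have hIcc : Finset.Icc 1 n = Finset.Ico (0 + 1) (n + 1) := by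
    ext j
    simp
  unfold opL quadraticError linearError
  rw [hint, last_coeff_opL hα1, mul_smul, ← smul_add, ← smul_sub, Nat.add_sub_cancel, hIcc,
    ← Finset.sum_Ico_add', ← Finset.range_eq_Ico, Finset.sum_sub_distrib]
  simp only [Nat.add_sub_cancel]
  congr 1
  abel

variable [CompleteSpace E]

theorem norm_quadraticError_le (h : WeaklySingular α T B u v1 v2 v3) (hα0 : 0 < α) (hα1 : α < 1)
    {t : ℕ → ℝ} (ht : StrictMono t) {n i : ℕ} (hi : i < n) (hti : 0 < t i) (hn : t (n + 1) ≤ T) :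
    ‖quadraticError α t u v1 n i‖ ≤
      (1 / (node α t (n + 1) - t (i + 1)) ^ α - 1 / (node α t (n + 1) - t i) ^ α) *
      (step t (i + 1) * (B * t i ^ (α - 3) * (3 * step t (i + 1) ^ 2 + step t (i + 2) ^ 2))) := by
  have hT : t (i + 2) ≤ T := (ht.monotone (by omega)).trans hn
  have hsub : Set.Icc (t i) (t (i + 2)) ⊆ Set.Ioc 0 T := fun s hs =>
    ⟨hti.trans_le hs.1, hs.2.trans hT⟩
  have hx : t (i + 1) < node α t (n + 1) := lt_node hα1 ht hi
  exact norm_quadratic_rule_sub_le (W := fun s => 1 / (node α t (n + 1) - s) ^ α)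
    (ht (Nat.lt_succ_self i)) (ht (Nat.lt_succ_self (i + 1)))
    (fun y hy => (h.d0 y (hsub hy)).mono hsub) (fun y hy => (h.d1 y (hsub hy)).mono hsub)
    (fun y hy => (h.d2 y (hsub hy)).mono hsub)
    (fun y hy => h.norm_third_le hα1 hti hy.1 (hy.2.trans hT))
    (continuousOn_kernel hx) (monotoneOn_kernel hα0 hx)

theorem norm_linearError_le (h : WeaklySingular α T B u v1 v2 v3) (hα0 : 0 < α) (hα1 : α < 1)
    {t : ℕ → ℝ} (ht : StrictMono t) {n : ℕ} (htn : 0 < t n) (hn : t (n + 1) ≤ T) :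
    ‖linearError α t u v1 n‖ ≤
      2 * B / (1 - α) * t n ^ (α - 3) * step t (n + 1) ^ (3 - α) := by
  have hsub : Set.Icc (t n) (t (n + 1)) ⊆ Set.Ioc 0 T := fun s hs =>
    ⟨htn.trans_le hs.1, hs.2.trans hn⟩
  have hσ : 0 < 1 - α / 2 := by linarith
  have hτ := step_pos ht (Nat.le_add_left 1 n)
  have hx : t n < node α t (n + 1) := lt_node hα1 ht le_rfl
  have hxeq : node α t (n + 1) = t n + (1 - α / 2) * (t (n + 1) - t n) := rfl
  have hB := h.nonneg ((hsub ⟨le_rfl, (ht (Nat.lt_succ_self n)).le⟩).1.trans_le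
    (hsub ⟨le_rfl, (ht (Nat.lt_succ_self n)).le⟩).2)
  have hκ : ∫ s in t n..node α t (n + 1), 1 / (node α t (n + 1) - s) ^ α =
      (1 - α / 2) ^ (1 - α) / ((1 - α) * step t (n + 1) ^ α) * (t (n + 1) - t n) := by
    rw [integral_kernel hα1 hx.le, node_succ, add_sub_cancel_left, Real.mul_rpow hσ.le hτ.le,
      Real.rpow_sub hτ 1 α, Real.rpow_one, show t (n + 1) - t n = step t (n + 1) from rfl]
    have : 1 - α ≠ 0 := by linarith
    have : 0 < step t (n + 1) ^ α := by positivity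
    field_simp
  have := norm_linear_rule_sub_le (W := fun s => 1 / (node α t (n + 1) - s) ^ α)
    (ht (Nat.lt_succ_self n)) hx (node_le hα0 ht n)
    (fun y hy => (h.d0 y (hsub hy)).mono hsub) (fun y hy => (h.d1 y (hsub hy)).mono hsub)
    (fun y hy => (h.d2 y (hsub hy)).mono hsub)
    (fun y hy => h.norm_third_le hα1 htn hy.1 (hy.2.trans hn))
    (intervalIntegrable_kernel hα1 hx.le)
    (fun s hs => by
      have : 0 ≤ node α t (n + 1) - s := by linarith [hs.2]
      positivity)
    hκ (by
      have := integral_kernel_mul_sub_midpoint hα0 hα1 (ht (Nat.lt_succ_self n))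
      rwa [← hxeq] at this)
  refine this.trans ?_
  rw [← hκ, integral_kernel hα1 hx.le, show t (n + 1) - t n = step t (n + 1) from rfl, node_succ,
    add_sub_cancel_left, show 3 - α = (1 - α) + 2 by ring, Real.rpow_add hτ, Real.rpow_two]
  have h1 : ((1 - α / 2) * step t (n + 1)) ^ (1 - α) ≤ step t (n + 1) ^ (1 - α) := by
    apply Real.rpow_le_rpow (by positivity) _ (by linarith)
    nlinarith
  have h2 : 0 < 1 - α := by linarith
  calc _ ≤ step t (n + 1) ^ (1 - α) / (1 - α) *
        (2 * (B * t n ^ (α - 3)) * step t (n + 1) ^ 2) := by gcongr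
    _ = _ := by ring

/-- Third derivatives are useless next to `0`. The integral and both interpolation terms, written in
differences of `u`, are bounded separately by the kernel at `t 1` and the growth bound for `u`. -/
theorem norm_quadraticError_zero_le (h : WeaklySingular α T B u v1 v2 v3) (hα0 : 0 < α)
    (hα1 : α < 1) {t : ℕ → ℝ} (ht : StrictMono t) (ht0 : t 0 = 0) {n : ℕ} (hn0 : 0 < n)
    (hn : t (n + 1) ≤ T) :
    ‖quadraticError α t u v1 n 0‖ ≤ 1 / (node α t (n + 1) - t 1) ^ α *
      (B / α * (2 + step t 1 / step t 2) * t 2 ^ α) := by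
  have hx : t 1 < node α t (n + 1) := lt_node hα1 ht hn0
  have ht1 : 0 < t 1 := ht0 ▸ ht Nat.zero_lt_one
  have ht12 : t 1 < t 2 := ht (by norm_num)
  have hT2 : t 2 ≤ T := (ht.monotone (by omega)).trans hn
  have hB := h.nonneg ((ht1.trans ht12).trans_le hT2)
  have hs1 := step_pos ht (le_refl 1)
  have hs2 := step_pos ht (Nat.le_succ 1)
  set W1 := 1 / (node α t (n + 1) - t 1) ^ α with hW1
  have hW1p : 0 < W1 := kernel_pos hx
  have hA0 : 0 ≤ -coeffA α t (n + 1) 1 :=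
    (kernel_pos (lt_node hα1 ht (Nat.zero_le n))).le.trans (le_neg_coeffA hα0 hα1 ht (j := 0) hn0)
  have hA1 : -coeffA α t (n + 1) 1 ≤ W1 := by
    have := neg_coeffA_le hα0 hα1 ht (j := 0) hn0
    have h0 : 0 < node α t (n + 1) - t 0 := by
      have := lt_node hα1 ht (Nat.zero_le n)
      linarith
    have h1 : 0 ≤ α * (node α t (n + 1) - t 0) ^ (-α - 1) * step t (0 + 1) / 2 := by positivity
    simp only [zero_add] at this h1
    linarith
  have hC0 := coeffC_nonneg hα0 hα1 ht (j := 1) hn0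
  have hC1 : coeffC α t (n + 1) 1 ≤ W1 * (step t 1 / step t 2) := by
    have := intervalIntegral.norm_integral_le_of_norm_le_const (a := t 0) (b := t 1)
      (f := fun s => (2 * s - t 0 - t 1) / (step t 2 * (step t 1 + step t 2)) *
        (1 / (node α t (n + 1) - s) ^ α)) (C := 1 / step t 2 * W1) (by
        intro s hs
        rw [Set.uIoc_of_le (ht0.le.trans ht1.le)] at hs
        have hk := kernel_pos (α := α) (hs.2.trans_lt hx)
        rw [norm_mul, Real.norm_eq_abs, Real.norm_eq_abs, abs_of_pos hk]
        have hden : 0 < step t 2 * (step t 1 + step t 2) := by positivity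
        apply mul_le_mul _ (kernel_mono hα0 hx hs.2) hk.le (by positivity)
        rw [abs_div, abs_of_pos hden, div_le_div_iff₀ hden hs2]
        have e : step t 1 = t 1 - t 0 := rfl
        have : |2 * s - t 0 - t 1| ≤ step t 1 + step t 2 := by
          rw [abs_le]
          constructor <;> linarith [hs.1, hs.2]
        nlinarith)
    rw [abs_of_pos (by linarith)] at this
    calc coeffC α t (n + 1) 1 ≤ _ := le_abs_self _
      _ ≤ _ := this
      _ = _ := by
        rw [show step t 1 = t 1 - t 0 from rfl]
        ring
  have hI := h.norm_integral_smul_le hα0 (W := fun s => 1 / (node α t (n + 1) - s) ^ α) (C := W1)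
    ht1 (ht12.le.trans hT2) (fun s hs => (kernel_pos (hs.2.trans_lt hx)).le)
    (fun s hs => kernel_mono hα0 hx hs.2)
  have hu1 := h.norm_sub_le hα0 le_rfl ht1.le (ht12.le.trans hT2)
  have hu2 := h.norm_sub_le hα0 ht1.le ht12.le hT2
  have hpow : t 1 ^ α ≤ t 2 ^ α := Real.rpow_le_rpow ht1.le ht12.le hα0.le
  have e : quadraticError α t u v1 n 0 =
      (∫ s in (0 : ℝ)..t 1, (1 / (node α t (n + 1) - s) ^ α) • v1 s) -
        (-coeffA α t (n + 1) 1) • (u (t 1) - u 0) -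
        coeffC α t (n + 1) 1 • (u (t 2) - u (t 1)) := by
    unfold quadraticError
    have := coeff_sum hα1 ht (j := 0) hn0
    simp only [zero_add] at this ⊢
    rw [this, ht0]
    module
  rw [e]
  calc _ ≤ W1 * (B / α * t 1 ^ α) + W1 * (B / α * t 1 ^ α) +
        W1 * (step t 1 / step t 2) * (B / α * t 2 ^ α) := by
        refine (_root_.norm_sub_le _ _).trans (add_le_add ((_root_.norm_sub_le _ _).trans
          (add_le_add hI ?_)) ?_)
        · rw [norm_smul, Real.norm_eq_abs, abs_of_nonneg hA0]
          gcongr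
        · rw [norm_smul, Real.norm_eq_abs, abs_of_nonneg hC0]
          gcongr
    _ ≤ W1 * (B / α * t 2 ^ α) + W1 * (B / α * t 2 ^ α) +
        W1 * (step t 1 / step t 2) * (B / α * t 2 ^ α) := by gcongr
    _ = _ := by ring

end Truncation

/-! ### Summation of the local errors on the graded mesh. -/

section GlobalTruncation

/-- Below `m` the denominators are dropped and the sum telescopes to at most `V m`; from `m` on they
are at least `m + 2`. Truncating with `min _ (V m)` makes both regimes one telescoping sum. -/
theorem sum_sub_div_le {V : ℕ → ℝ} {p m : ℕ} (hV0 : 0 ≤ V 0)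
    (hV : ∀ i j, i ≤ j → j ≤ p → V i ≤ V j) (hm : m ≤ p) :
    ∑ i ∈ Finset.range p, (V (i + 1) - V i) / (i + 2) ≤ V m + V p / (m + 2) := by
  have hterm : ∀ i ∈ Finset.range p, (V (i + 1) - V i) / ((i : ℝ) + 2) ≤
      (min (V (i + 1)) (V m) + V (i + 1) / (m + 2)) - (min (V i) (V m) + V i / (m + 2)) := by
    intro i hi
    have hip : i + 1 ≤ p := Finset.mem_range.1 hi
    have hd : 0 ≤ V (i + 1) - V i := sub_nonneg.2 (hV i (i + 1) (by omega) hip)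
    have e : (min (V (i + 1)) (V m) + V (i + 1) / ((m : ℝ) + 2)) -
        (min (V i) (V m) + V i / (m + 2)) =
        min (V (i + 1)) (V m) - min (V i) (V m) + (V (i + 1) - V i) / (m + 2) := by ring
    rw [e]
    rcases Nat.lt_or_ge i m with h | h
    · rw [min_eq_left (hV (i + 1) m h hm), min_eq_left (hV i m h.le hm)]
      have h1 : (V (i + 1) - V i) / ((i : ℝ) + 2) ≤ V (i + 1) - V i := by
        apply div_le_self hd
        have : (0 : ℝ) ≤ i := by positivity
        linarith
      have h2 : 0 ≤ (V (i + 1) - V i) / ((m : ℝ) + 2) := by positivity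
      linarith
    · rw [min_eq_right (hV m (i + 1) (by omega) hip), min_eq_right (hV m i h (by omega)), sub_self,
        zero_add]
      have : (m : ℝ) ≤ i := by exact_mod_cast h
      gcongr
  refine (Finset.sum_le_sum hterm).trans ?_
  rw [Finset.sum_range_sub (fun i => min (V i) (V m) + V i / ((m : ℝ) + 2))]
  have h1 : min (V p) (V m) ≤ V m := min_le_right _ _
  have h2 : 0 ≤ min (V 0) (V m) := le_min hV0 (hV0.trans (hV 0 m (Nat.zero_le _) hm))
  have h3 : 0 ≤ V 0 / ((m : ℝ) + 2) := by positivity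
  linarith

variable {α T B r : ℝ} {K : ℕ}

theorem gradedMesh_prev_rpow_le (hr : 0 < r) (hT : 0 < T) (hK : 1 ≤ K) {β : ℝ} (hβ : β ≤ 0) {i : ℕ}
    (hi : 1 ≤ i) :
    gradedMesh r T K i ^ β ≤ ((2 : ℝ) ^ r)⁻¹ ^ β * gradedMesh r T K (i + 1) ^ β := by
  have h1 := gradedMesh_succ_le (K := K) hr hT hi
  have h2 := gradedMesh_pos hr hT hK (Nat.le_add_left 1 i)
  rw [← Real.mul_rpow (by positivity) h2.le]
  apply Real.rpow_le_rpow_of_nonpos (by positivity) _ hβ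
  rwa [inv_mul_le_iff₀ (by positivity)]

/-- In the first half of the indices `t i ≤ 2^(-r) t_{n+1}`, so `t* - t i` is comparable with
`t_{n+1}`. The node is the convex combination `σ t_{n+1} + (α/2) t_n`, and the part with `t_n ≥ t i`
can be discarded. -/
theorem kernel_mul_rpow_le_of_half (hα0 : 0 < α) (hα1 : α < 1) (hr : 0 < r) (hT : 0 < T)
    (hK : 1 ≤ K) {n i : ℕ} (hi : 2 * i ≤ n + 1) :
    1 / (node α (gradedMesh r T K) (n + 1) - gradedMesh r T K i) ^ α *
      gradedMesh r T K (n + 1) ^ α ≤ 1 / ((1 - α / 2) * (1 - (1 / 2) ^ r)) ^ α := by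
  have ht := gradedMesh_strictMono hr hT hK
  have hσ : 0 < 1 - α / 2 := by linarith
  have hk := gradedMesh_pos hr hT hK (Nat.le_add_left 1 n)
  have h1 : gradedMesh r T K i ≤ (1 / 2) ^ r * gradedMesh r T K (n + 1) := by
    apply gradedMesh_le_rpow_mul hr hT (by norm_num)
    have : (2 : ℝ) * i ≤ (n + 1 : ℕ) := by exact_mod_cast hi
    linarith
  have h2 : ((1 : ℝ) / 2) ^ r < 1 := Real.rpow_lt_one (by norm_num) (by norm_num) hr
  have h2' : 0 < 1 - ((1 : ℝ) / 2) ^ r := by linarith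
  have h3 : gradedMesh r T K i ≤ gradedMesh r T K n := ht.monotone (by omega)
  have h4 : (1 - α / 2) * (1 - (1 / 2) ^ r) * gradedMesh r T K (n + 1) ≤
      node α (gradedMesh r T K) (n + 1) - gradedMesh r T K i := by
    rw [node_succ, show step (gradedMesh r T K) (n + 1) =
      gradedMesh r T K (n + 1) - gradedMesh r T K n from rfl]
    have h5 : (1 - α / 2) * gradedMesh r T K i ≤
        (1 - α / 2) * ((1 / 2) ^ r * gradedMesh r T K (n + 1)) := by gcongr
    have h6 : α / 2 * gradedMesh r T K i ≤ α / 2 * gradedMesh r T K n := by gcongr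
    linarith
  have h7 : 0 < (1 - α / 2) * (1 - (1 / 2 : ℝ) ^ r) := mul_pos hσ h2'
  rw [div_mul_eq_mul_div, one_mul, div_le_div_iff₀, one_mul]
  · rw [← Real.mul_rpow hk.le h7.le]
    apply Real.rpow_le_rpow (by positivity) _ hα0.le
    linarith
  · apply Real.rpow_pos_of_pos
    exact (mul_pos h7 hk).trans_le h4
  · positivity

/-- At the last mesh point the kernel is larger than `t_{n+1}^(-α)` by up to order `(n+1)^α`. The
cruder factor `n + 1` suffices, since it is divided by half of the index range. -/
theorem kernel_last_mul_rpow_le (hα0 : 0 < α) (hα1 : α < 1) (hr : 0 < r) (hT : 0 < T)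
    (hK : 1 ≤ K) (n : ℕ) :
    1 / (node α (gradedMesh r T K) (n + 1) - gradedMesh r T K n) ^ α *
      gradedMesh r T K (n + 1) ^ α ≤ 1 / ((1 - α / 2) * min r 1) ^ α * ((n : ℝ) + 1) := by
  have hσ : 0 < 1 - α / 2 := by linarith
  have hk := gradedMesh_pos hr hT hK (Nat.le_add_left 1 n)
  have hc : 0 < min r 1 := lt_min hr one_pos
  have h1 := le_step_gradedMesh (K := K) hr hT (Nat.le_add_left 1 n)
  have hn : (0 : ℝ) < (n : ℝ) + 1 := by positivity
  push_cast at h1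
  have h2 : 0 < min r 1 * gradedMesh r T K (n + 1) / ((n : ℝ) + 1) := by positivity
  rw [node_succ, add_sub_cancel_left]
  calc _ ≤ 1 / ((1 - α / 2) * (min r 1 * gradedMesh r T K (n + 1) / ((n : ℝ) + 1))) ^ α *
        gradedMesh r T K (n + 1) ^ α := by
        gcongr
    _ = 1 / ((1 - α / 2) * min r 1) ^ α * ((n : ℝ) + 1) ^ α := by
        rw [show (1 - α / 2) * (min r 1 * gradedMesh r T K (n + 1) / ((n : ℝ) + 1)) =
          (1 - α / 2) * min r 1 * gradedMesh r T K (n + 1) / ((n : ℝ) + 1) by ring,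
          Real.div_rpow (by positivity) hn.le, Real.mul_rpow (by positivity) hk.le]
        have : 0 < gradedMesh r T K (n + 1) ^ α := by positivity
        have : 0 < ((1 - α / 2) * min r 1) ^ α := by positivity
        field_simp
    _ ≤ _ := by
        gcongr
        exact Real.rpow_le_self_of_one_le (by linarith [(Nat.cast_nonneg n : (0 : ℝ) ≤ n)]) hα1.le

/-- Each step contributes a factor `t_{i+1} / (i+1)`. The three factors turn `t^(α-3)` into `t^α /
(i+1)³`, and `gradedMesh_rpow_le` uses up two of the three powers of `i + 1`. -/
theorem quadratic_weight_le (hα0 : 0 < α) (hα1 : α < 1) (hr : 0 < r) (hT : 0 < T)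
    (hK : 1 ≤ K) (hB : 0 ≤ B) {i : ℕ} (hi : 1 ≤ i) (hiK : i + 1 ≤ K) :
    step (gradedMesh r T K) (i + 1) * (B * gradedMesh r T K i ^ (α - 3) *
      (3 * step (gradedMesh r T K) (i + 1) ^ 2 + step (gradedMesh r T K) (i + 2) ^ 2)) ≤
    B * max r 1 ^ 3 * (3 + (2 ^ r) ^ 2) * ((2 : ℝ) ^ r)⁻¹ ^ (α - 3) *
      (T ^ α / (K : ℝ) ^ min (r * α) 2) / ((i : ℝ) + 1) := by
  have ht := gradedMesh_strictMono hr hT hK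
  have hs1 := step_pos ht (Nat.le_add_left 1 i)
  have hs2 := step_pos ht (Nat.le_add_left 1 (i + 1))
  have h1 := step_gradedMesh_le (K := K) hr hT (Nat.le_add_left 1 i)
  have h2 := step_gradedMesh_le (K := K) hr hT (Nat.le_add_left 1 (i + 1))
  have h3 := gradedMesh_succ_le (K := K) hr hT (Nat.le_add_left 1 i)
  have h4 := gradedMesh_prev_rpow_le hr hT hK (β := α - 3) (by linarith) hi
  have h5 := gradedMesh_rpow_le hr hT hα0 (Nat.le_add_left 1 i) hiK
  have hy := gradedMesh_pos hr hT hK (Nat.le_add_left 1 i)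
  have hti := gradedMesh_pos hr hT hK hi
  push_cast at h1 h2 h5
  set y := gradedMesh r T K (i + 1) with hy_def
  set c := max r 1 with hc_def
  have hc : 0 < c := lt_of_lt_of_le one_pos (le_max_right _ _)
  set J : ℝ := (i : ℝ) + 1 with hJ
  have hJ0 : 0 < J := by positivity
  have h2' : step (gradedMesh r T K) (i + 1 + 1) ≤ 2 ^ r * (c * y / J) := by
    refine h2.trans ?_
    calc c * gradedMesh r T K (i + 1 + 1) / (J + 1) ≤ c * (2 ^ r * y) / J := by
          gcongr
          linarith
      _ = _ := by ring
  have h6 : y ^ (α - 3) * y ^ 3 = y ^ α := by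
    rw [← Real.rpow_natCast y 3, ← Real.rpow_add hy]
    norm_num
  calc _ ≤ c * y / J * (B * (((2 : ℝ) ^ r)⁻¹ ^ (α - 3) * y ^ (α - 3)) *
        (3 * (c * y / J) ^ 2 + (2 ^ r * (c * y / J)) ^ 2)) := by gcongr
    _ = B * c ^ 3 * (3 + (2 ^ r) ^ 2) * ((2 : ℝ) ^ r)⁻¹ ^ (α - 3) * (y ^ (α - 3) * y ^ 3) / J ^ 3 := by
        field_simp
    _ ≤ B * c ^ 3 * (3 + (2 ^ r) ^ 2) * ((2 : ℝ) ^ r)⁻¹ ^ (α - 3) *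
        (T ^ α * J ^ 2 / (K : ℝ) ^ min (r * α) 2) / J ^ 3 := by
        rw [h6]
        gcongr
    _ = _ := by
        field_simp

variable {E : Type*} [NormedAddCommGroup E] [NormedSpace ℝ E] [CompleteSpace E]
  {u v1 v2 v3 : ℝ → E}

theorem sum_norm_quadraticError_le (hα0 : 0 < α) (hα1 : α < 1) (hr : 0 < r) (hT : 0 < T)
    (hK : 1 ≤ K) (h : WeaklySingular α T B u v1 v2 v3) {p : ℕ} (hp : p + 2 ≤ K) :
    gradedMesh r T K (p + 2) ^ α *
      ∑ i ∈ Finset.range p, ‖quadraticError α (gradedMesh r T K) u v1 (p + 1) (i + 1)‖ ≤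
    B * max r 1 ^ 3 * (3 + (2 ^ r) ^ 2) * ((2 : ℝ) ^ r)⁻¹ ^ (α - 3) *
      (1 / ((1 - α / 2) * (1 - (1 / 2) ^ r)) ^ α + 2 * (1 / ((1 - α / 2) * min r 1) ^ α)) *
      (T ^ α / (K : ℝ) ^ min (r * α) 2) := by
  have ht := gradedMesh_strictMono hr hT hK
  have hB := h.nonneg hT
  set t := gradedMesh r T K with ht_def
  set G := B * max r 1 ^ 3 * (3 + (2 ^ r) ^ 2) * ((2 : ℝ) ^ r)⁻¹ ^ (α - 3) with hG
  set X := T ^ α / (K : ℝ) ^ min (r * α) 2 with hX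
  have hc : 0 < min r 1 := lt_min hr one_pos
  have hσ : 0 < 1 - α / 2 := by linarith
  have hX0 : 0 ≤ X := by positivity
  have hG0 : 0 ≤ G := by positivity
  have htp : t (p + 1 + 1) ≤ T := gradedMesh_le hr hT hK hp
  have hty : 0 < t (p + 2) := gradedMesh_pos hr hT hK (by omega)
  set V : ℕ → ℝ := fun i => 1 / (node α t (p + 1 + 1) - t (i + 1)) ^ α with hV
  have hVmono : ∀ i j, i ≤ j → j ≤ p → V i ≤ V j := fun i j hij hj =>
    kernel_mono hα0 (lt_node hα1 ht (by omega)) (ht.monotone (by omega))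
  have hV0 : 0 ≤ V 0 := (kernel_pos (lt_node hα1 ht (by omega))).le
  have hterm : ∀ i ∈ Finset.range p, ‖quadraticError α t u v1 (p + 1) (i + 1)‖ ≤
      G * X * ((V (i + 1) - V i) / ((i : ℝ) + 2)) := by
    intro i hi
    have hip := Finset.mem_range.1 hi
    refine (norm_quadraticError_le h hα0 hα1 ht (by omega)
      (gradedMesh_pos hr hT hK (by omega)) htp).trans ?_
    have hq := quadratic_weight_le hα0 hα1 hr hT hK hB (i := i + 1) (by omega) (by omega)
    have hd : 0 ≤ V (i + 1) - V i := sub_nonneg.2 (hVmono i (i + 1) (by omega) (by omega))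
    refine (mul_le_mul_of_nonneg_left hq hd).trans (le_of_eq ?_)
    rw [← hG, ← hX]
    push_cast
    ring
  -- Cutting at `p / 2` keeps the shifted index `p / 2 + 1` within half of `p + 2`, while `p / 2 +
  -- 2` still compensates the factor `p + 2` from the last kernel value.
  have hmp : p / 2 ≤ p := Nat.div_le_self _ _
  have hsum := sum_sub_div_le hV0 hVmono hmp
  have hA := kernel_mul_rpow_le_of_half hα0 hα1 hr hT hK (n := p + 1) (i := p / 2 + 1) (by omega)
  have hL := kernel_last_mul_rpow_le hα0 hα1 hr hT hK (p + 1)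
  have hdiv : ((p : ℝ) + 2) ≤ 2 * (((p / 2 : ℕ) : ℝ) + 2) := by
    have : p + 2 ≤ 2 * (p / 2 + 2) := by omega
    exact_mod_cast this
  set m : ℕ := p / 2 with hm
  have hm0 : (0 : ℝ) < (m : ℝ) + 2 := by positivity
  have hL' : V p / ((m : ℝ) + 2) * t (p + 2) ^ α ≤ 2 * (1 / ((1 - α / 2) * min r 1) ^ α) := by
    rw [div_mul_eq_mul_div, div_le_iff₀ hm0]
    refine hL.trans ?_
    have : 0 ≤ 1 / ((1 - α / 2) * min r 1) ^ α := by positivity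
    push_cast
    nlinarith
  calc _ ≤ t (p + 2) ^ α * (G * X * (V m + V p / ((m : ℝ) + 2))) := by
        gcongr
        refine (Finset.sum_le_sum hterm).trans ?_
        rw [← Finset.mul_sum]
        gcongr
    _ = G * (V m * t (p + 2) ^ α + V p / ((m : ℝ) + 2) * t (p + 2) ^ α) * X := by ring
    _ ≤ _ := by
        gcongr

theorem rpow_mul_norm_linearError_le (hα0 : 0 < α) (hα1 : α < 1) (hr : 0 < r) (hT : 0 < T)
    (hK : 1 ≤ K) (h : WeaklySingular α T B u v1 v2 v3) {n : ℕ} (hn : 1 ≤ n) (hnK : n + 1 ≤ K) :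
    gradedMesh r T K (n + 1) ^ α * ‖linearError α (gradedMesh r T K) u v1 n‖ ≤
    2 * B / (1 - α) * ((2 : ℝ) ^ r)⁻¹ ^ (α - 3) * max r 1 ^ (3 - α) *
      (T ^ α / (K : ℝ) ^ min (r * α) 2) := by
  have ht := gradedMesh_strictMono hr hT hK
  have hB := h.nonneg hT
  have h1α : 0 < 1 - α := by linarith
  have hy := gradedMesh_pos hr hT hK (Nat.le_add_left 1 n)
  have hs := step_pos ht (Nat.le_add_left 1 n)
  have h1 := step_gradedMesh_le (K := K) hr hT (Nat.le_add_left 1 n)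
  have h4 := gradedMesh_prev_rpow_le hr hT hK (β := α - 3) (by linarith) hn
  have h5 := gradedMesh_rpow_le hr hT hα0 (Nat.le_add_left 1 n) hnK
  have h6 := norm_linearError_le h hα0 hα1 ht (gradedMesh_pos hr hT hK hn)
    (gradedMesh_le hr hT hK hnK)
  push_cast at h1 h5
  set y := gradedMesh r T K (n + 1) with hy_def
  set c := max r 1 with hc_def
  have hc : 0 < c := lt_of_lt_of_le one_pos (le_max_right _ _)
  set J : ℝ := (n : ℝ) + 1 with hJ
  have hJ1 : 1 ≤ J := by
    rw [hJ]
    linarith [(Nat.cast_nonneg n : (0 : ℝ) ≤ n)]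
  have hJ0 : 0 < J := by linarith
  have h7 : y ^ (α - 3) * y ^ (3 - α) = 1 := by
    rw [← Real.rpow_add hy]
    simp
  -- The step yields `J^(α-3)`, and `α < 1` makes it dominate the factor `J²` from the mesh bound.
  have h8 : J ^ 2 ≤ J ^ (3 - α) := by
    rw [← Real.rpow_natCast J 2]
    apply Real.rpow_le_rpow_of_exponent_le hJ1
    push_cast
    linarith
  calc _ ≤ (T ^ α * J ^ 2 / (K : ℝ) ^ min (r * α) 2) * (2 * B / (1 - α) *
        (((2 : ℝ) ^ r)⁻¹ ^ (α - 3) * y ^ (α - 3)) * (c * y / J) ^ (3 - α)) := by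
        have hpow : step (gradedMesh r T K) (n + 1) ^ (3 - α) ≤ (c * y / J) ^ (3 - α) :=
          Real.rpow_le_rpow hs.le h1 (by linarith)
        gcongr
        refine h6.trans ?_
        gcongr
    _ = 2 * B / (1 - α) * ((2 : ℝ) ^ r)⁻¹ ^ (α - 3) * c ^ (3 - α) *
        (T ^ α / (K : ℝ) ^ min (r * α) 2) * (y ^ (α - 3) * y ^ (3 - α)) *
        (J ^ 2 / J ^ (3 - α)) := by
        rw [Real.div_rpow (by positivity) hJ0.le, Real.mul_rpow hc.le hy.le]
        ring
    _ ≤ 2 * B / (1 - α) * ((2 : ℝ) ^ r)⁻¹ ^ (α - 3) * c ^ (3 - α) *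
        (T ^ α / (K : ℝ) ^ min (r * α) 2) * (y ^ (α - 3) * y ^ (3 - α)) * 1 := by
        gcongr
        exact (div_le_one (by positivity)).2 h8
    _ = _ := by rw [h7, mul_one, mul_one]

theorem rpow_mul_norm_quadraticError_zero_le (hα0 : 0 < α) (hα1 : α < 1) (hr : 0 < r) (hT : 0 < T)
    (hK : 1 ≤ K) (h : WeaklySingular α T B u v1 v2 v3) {n : ℕ} (hn : 1 ≤ n) (hnK : n + 1 ≤ K) :
    gradedMesh r T K (n + 1) ^ α * ‖quadraticError α (gradedMesh r T K) u v1 n 0‖ ≤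
    1 / ((1 - α / 2) * (1 - (1 / 2) ^ r)) ^ α * (B / α * (2 + 2 / min r 1) * 4) *
      (T ^ α / (K : ℝ) ^ min (r * α) 2) := by
  have ht := gradedMesh_strictMono hr hT hK
  have hB := h.nonneg hT
  have hc : 0 < min r 1 := lt_min hr one_pos
  have h1 := norm_quadraticError_zero_le h hα0 hα1 ht (gradedMesh_zero hr) hn
    (gradedMesh_le hr hT hK hnK)
  have h2 := kernel_mul_rpow_le_of_half hα0 hα1 hr hT hK (n := n) (i := 1) (by omega)
  have h3 := gradedMesh_rpow_le hr hT hα0 (k := 2) (by norm_num) (show 2 ≤ K by omega)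
  have h4 := le_step_gradedMesh (K := K) hr hT (k := 2) (by norm_num)
  have ht2 := gradedMesh_pos hr hT hK (k := 2) (by norm_num)
  have hy := gradedMesh_pos hr hT hK (Nat.le_add_left 1 n)
  have hs1 := step_pos ht (le_refl 1)
  have hs2 := step_pos ht (Nat.le_succ 1)
  have h5 : step (gradedMesh r T K) 1 / step (gradedMesh r T K) 2 ≤ 2 / min r 1 := by
    rw [div_le_div_iff₀ hs2 hc]
    have e : step (gradedMesh r T K) 1 = gradedMesh r T K 1 := by
      simp [step, gradedMesh_zero hr]
    have h12 : gradedMesh r T K 1 ≤ gradedMesh r T K 2 := ht.monotone (by norm_num)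
    rw [e]
    push_cast at h4
    nlinarith
  have h6 : 0 ≤ 1 / (node α (gradedMesh r T K) (n + 1) - gradedMesh r T K 1) ^ α :=
    (kernel_pos (lt_node hα1 ht hn)).le
  push_cast at h3
  calc _ ≤ gradedMesh r T K (n + 1) ^ α *
        (1 / (node α (gradedMesh r T K) (n + 1) - gradedMesh r T K 1) ^ α *
        (B / α * (2 + 2 / min r 1) * (T ^ α * 2 ^ 2 / (K : ℝ) ^ min (r * α) 2))) := by
        gcongr
        refine h1.trans ?_
        gcongr
    _ = 1 / (node α (gradedMesh r T K) (n + 1) - gradedMesh r T K 1) ^ α *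
        gradedMesh r T K (n + 1) ^ α *
        ((B / α * (2 + 2 / min r 1) * 4) * (T ^ α / (K : ℝ) ^ min (r * α) 2)) := by ring
    _ ≤ 1 / ((1 - α / 2) * (1 - (1 / 2) ^ r)) ^ α *
        ((B / α * (2 + 2 / min r 1) * 4) * (T ^ α / (K : ℝ) ^ min (r * α) 2)) := by gcongr
    _ = _ := by ring

theorem rpow_mul_norm_linearError_zero_le (hα0 : 0 < α) (hα1 : α < 1) (hr : 0 < r) (hT : 0 < T)
    (hK : 1 ≤ K) (h : WeaklySingular α T B u v1 v2 v3) :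
    gradedMesh r T K 1 ^ α * ‖linearError α (gradedMesh r T K) u v1 0‖ ≤
    (B / α + B / (1 - α) + 1 / (1 - α) * (B / α)) * (T ^ α / (K : ℝ) ^ min (r * α) 2) := by
  have ht := gradedMesh_strictMono hr hT hK
  have hB := h.nonneg hT
  have h1α : 0 < 1 - α := by linarith
  have hσ : 0 < 1 - α / 2 := by linarith
  have ht1 := gradedMesh_pos hr hT hK (le_refl 1)
  have hT1 : gradedMesh r T K 1 ≤ T := gradedMesh_le hr hT hK hK
  have h0 := gradedMesh_zero (T := T) (K := K) hr
  have hx0 : 0 < node α (gradedMesh r T K) (0 + 1) := by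
    have := lt_node hα1 ht (le_refl 0)
    rwa [h0] at this
  have hxT : node α (gradedMesh r T K) (0 + 1) ≤ T := (node_le hα0 ht 0).trans hT1
  have h3 := gradedMesh_rpow_le hr hT hα0 (k := 1) le_rfl hK
  have hI := h.norm_first_integral_le hα0 hα1 hx0 hxT
  have hu := h.norm_sub_le hα0 le_rfl ht1.le hT1
  have hcoef : (1 - α / 2) ^ (1 - α) ≤ 1 := Real.rpow_le_one hσ.le (by linarith) h1α.le
  have hstep : step (gradedMesh r T K) 1 = gradedMesh r T K 1 := by
    simp [step, h0]
  have hlin : ‖linearError α (gradedMesh r T K) u v1 0‖ ≤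
      B / α + B / (1 - α) + 1 / (1 - α) * (B / α) := by
    unfold linearError
    rw [h0]
    refine (_root_.norm_sub_le _ _).trans (add_le_add hI ?_)
    rw [zero_add, hstep, norm_smul, Real.norm_eq_abs, abs_of_nonneg (by positivity)]
    calc _ ≤ 1 / ((1 - α) * gradedMesh r T K 1 ^ α) * (B / α * gradedMesh r T K 1 ^ α) := by gcongr
      _ = _ := by
        have : 0 < gradedMesh r T K 1 ^ α := by positivity
        field_simp
  calc _ ≤ (T ^ α / (K : ℝ) ^ min (r * α) 2) * (B / α + B / (1 - α) + 1 / (1 - α) * (B / α)) := by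
        gcongr
        simpa using h3
    _ = _ := by ring

/-- The truncation error of the L2-1σ operator on the graded mesh. -/
theorem exists_truncation_bound (hα0 : 0 < α) (hα1 : α < 1) (hr : 0 < r) (hT : 0 < T)
    (hB : 0 ≤ B) (E : Type*) [NormedAddCommGroup E] [NormedSpace ℝ E] [CompleteSpace E] :
    ∃ C : ℝ, 0 ≤ C ∧ ∀ u v1 v2 v3 : ℝ → E, WeaklySingular α T B u v1 v2 v3 → ∀ K : ℕ, 1 ≤ K →
      ∀ n < K, gradedMesh r T K (n + 1) ^ α *
        ‖caputo α u (node α (gradedMesh r T K) (n + 1)) -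
          opL α (gradedMesh r T K) (fun k => u (gradedMesh r T K k)) (n + 1)‖ ≤
        C * (1 / (K : ℝ) ^ min (r * α) 2) := by
  have hG := Real.Gamma_pos_of_pos (sub_pos.2 hα1)
  have h1α : 0 < 1 - α := by linarith
  have hσ : 0 < 1 - α / 2 := by linarith
  have hc : 0 < min r 1 := lt_min hr one_pos
  have hhalf : 0 < 1 - ((1 : ℝ) / 2) ^ r :=
    sub_pos.2 (Real.rpow_lt_one (by norm_num) (by norm_num) hr)
  -- The constants belong to the first interval, the interior intervals, the last interval, and the
  -- step `n = 0`. They are fixed before `u`, `K` and `n`, hence uniform.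
  obtain ⟨C1, hC1⟩ : ∃ C, C = 1 / ((1 - α / 2) * (1 - (1 / 2) ^ r)) ^ α *
    (B / α * (2 + 2 / min r 1) * 4) := ⟨_, rfl⟩
  obtain ⟨C2, hC2⟩ : ∃ C, C = B * max r 1 ^ 3 * (3 + (2 ^ r) ^ 2) * ((2 : ℝ) ^ r)⁻¹ ^ (α - 3) *
      (1 / ((1 - α / 2) * (1 - (1 / 2) ^ r)) ^ α + 2 * (1 / ((1 - α / 2) * min r 1) ^ α)) :=
    ⟨_, rfl⟩
  obtain ⟨C3, hC3⟩ : ∃ C, C = 2 * B / (1 - α) * ((2 : ℝ) ^ r)⁻¹ ^ (α - 3) * max r 1 ^ (3 - α) :=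
    ⟨_, rfl⟩
  obtain ⟨C4, hC4⟩ : ∃ C, C = B / α + B / (1 - α) + 1 / (1 - α) * (B / α) := ⟨_, rfl⟩
  have h1 : 0 ≤ C1 := by rw [hC1]; positivity
  have h2 : 0 ≤ C2 := by rw [hC2]; positivity
  have h3 : 0 ≤ C3 := by rw [hC3]; positivity
  have h4 : 0 ≤ C4 := by rw [hC4]; positivity
  refine ⟨(Real.Gamma (1 - α))⁻¹ * (C1 + C2 + C3 + C4) * T ^ α, by positivity, ?_⟩
  intro u v1 v2 v3 h K hK n hn
  have ht := gradedMesh_strictMono hr hT hK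
  rw [caputo_sub_opL h hα0 hα1 ht (gradedMesh_zero hr) (gradedMesh_le hr hT hK hn), norm_smul,
    norm_inv, Real.norm_eq_abs, abs_of_pos hG]
  set X := T ^ α / (K : ℝ) ^ min (r * α) 2 with hX
  have hX0 : 0 ≤ X := by positivity
  have hy := gradedMesh_pos hr hT hK (Nat.le_add_left 1 n)
  suffices hs : gradedMesh r T K (n + 1) ^ α *
      ‖∑ i ∈ Finset.range n, quadraticError α (gradedMesh r T K) u v1 n i +
        linearError α (gradedMesh r T K) u v1 n‖ ≤ (C1 + C2 + C3 + C4) * X by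
    calc _ = (Real.Gamma (1 - α))⁻¹ * (gradedMesh r T K (n + 1) ^ α *
        ‖∑ i ∈ Finset.range n, quadraticError α (gradedMesh r T K) u v1 n i +
        linearError α (gradedMesh r T K) u v1 n‖) := by ring
      _ ≤ (Real.Gamma (1 - α))⁻¹ * ((C1 + C2 + C3 + C4) * X) := by gcongr
      _ = _ := by
        rw [hX]
        ring
  rcases n with _ | p
  · have := rpow_mul_norm_linearError_zero_le hα0 hα1 hr hT hK h
    rw [← hC4, ← hX] at this
    simp only [Finset.range_zero, Finset.sum_empty, zero_add] at this ⊢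
    refine this.trans ?_
    gcongr
    linarith
  · have e1 := rpow_mul_norm_quadraticError_zero_le hα0 hα1 hr hT hK h (Nat.le_add_left 1 p) hn
    have e2 := sum_norm_quadraticError_le hα0 hα1 hr hT hK h hn
    have e3 := rpow_mul_norm_linearError_le hα0 hα1 hr hT hK h (Nat.le_add_left 1 p) hn
    rw [← hC1, ← hX] at e1
    rw [← hC2, ← hX] at e2
    rw [← hC3, ← hX] at e3
    have e4 : 0 ≤ C4 * X := by positivity
    have hle : ‖∑ i ∈ Finset.range (p + 1), quadraticError α (gradedMesh r T K) u v1 (p + 1) i +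
        linearError α (gradedMesh r T K) u v1 (p + 1)‖ ≤
        ‖quadraticError α (gradedMesh r T K) u v1 (p + 1) 0‖ +
        ∑ i ∈ Finset.range p, ‖quadraticError α (gradedMesh r T K) u v1 (p + 1) (i + 1)‖ +
        ‖linearError α (gradedMesh r T K) u v1 (p + 1)‖ := by
      rw [Finset.sum_range_succ']
      refine (norm_add_le _ _).trans (add_le_add ((norm_add_le _ _).trans ?_) le_rfl)
      rw [add_comm]
      gcongr
      exact norm_sum_le _ _
    have := mul_le_mul_of_nonneg_left hle (by positivity : 0 ≤ gradedMesh r T K (p + 1 + 1) ^ α)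
    rw [mul_add, mul_add] at this
    linarith

/-- The error of the linear interpolation at the node `t_k^*` on the graded mesh. -/
theorem exists_interpolation_bound (hα0 : 0 < α) (hα1 : α < 1) (hr : 0 < r) (hT : 0 < T)
    (hB : 0 ≤ B) (E : Type*) [NormedAddCommGroup E] [NormedSpace ℝ E] [CompleteSpace E] :
    ∃ C : ℝ, 0 ≤ C ∧ ∀ u v1 v2 v3 : ℝ → E, WeaklySingular α T B u v1 v2 v3 → ∀ K : ℕ, 1 ≤ K →
      ∀ n < K, ‖u (node α (gradedMesh r T K) (n + 1)) -
          ((1 - α / 2) • u (gradedMesh r T K (n + 1)) + (α / 2) • u (gradedMesh r T K n))‖ ≤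
        C * (1 / (K : ℝ) ^ min (r * α) 2) := by
  obtain ⟨C1, hC1⟩ : ∃ C, C = 2 * (B / α) := ⟨_, rfl⟩
  obtain ⟨C2, hC2⟩ : ∃ C, C = 2 * (B * ((2 : ℝ) ^ r)⁻¹ ^ (α - 2) * max r 1 ^ 2) := ⟨_, rfl⟩
  have h1 : 0 ≤ C1 := by rw [hC1]; positivity
  have h2 : 0 ≤ C2 := by rw [hC2]; positivity
  refine ⟨(C1 + C2) * T ^ α, by positivity, ?_⟩
  intro u v1 v2 v3 h K hK n hn
  have ht := gradedMesh_strictMono hr hT hK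
  have hσ : 0 < 1 - α / 2 := by linarith
  have hTn := gradedMesh_le (k := n + 1) hr hT hK hn
  have hy := gradedMesh_pos hr hT hK (Nat.le_add_left 1 n)
  have hs := step_pos ht (Nat.le_add_left 1 n)
  have h5 := gradedMesh_rpow_le hr hT hα0 (Nat.le_add_left 1 n) hn
  have hx1 : gradedMesh r T K n < node α (gradedMesh r T K) (n + 1) := lt_node hα1 ht le_rfl
  have hx2 := node_le hα0 ht n
  set t := gradedMesh r T K with ht_def
  set X := T ^ α / (K : ℝ) ^ min (r * α) 2 with hX
  have hX0 : 0 ≤ X := by positivity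
  set x := node α t (n + 1) with hx
  suffices hs : ‖u x - ((1 - α / 2) • u (t (n + 1)) + (α / 2) • u (t n))‖ ≤ (C1 + C2) * X by
    refine hs.trans (le_of_eq ?_)
    rw [hX]
    ring
  -- On the first step only the growth of `u` from its initial value is available. Later, linear
  -- interpolation is exact on affine functions, so two Taylor remainders at `t n` remain.
  rcases Nat.eq_zero_or_pos n with h0 | h0
  · subst h0
    have ht0 : t 0 = 0 := gradedMesh_zero hr
    rw [ht0] at hx1 ⊢
    have a1 := h.norm_sub_le hα0 le_rfl hx1.le (hx2.trans hTn)
    have a2 := h.norm_sub_le hα0 le_rfl hy.le hTn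
    have a3 : x ^ α ≤ t (0 + 1) ^ α := Real.rpow_le_rpow hx1.le hx2 hα0.le
    have e : u x - ((1 - α / 2) • u (t (0 + 1)) + (α / 2) • u 0) =
        (u x - u 0) - (1 - α / 2) • (u (t (0 + 1)) - u 0) := by module
    rw [e]
    calc _ ≤ ‖u x - u 0‖ + (1 - α / 2) * ‖u (t (0 + 1)) - u 0‖ := by
          refine (_root_.norm_sub_le _ _).trans (le_of_eq ?_)
          rw [norm_smul, Real.norm_eq_abs, abs_of_pos hσ]
      _ ≤ B / α * t (0 + 1) ^ α + 1 * (B / α * t (0 + 1) ^ α) := by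
          gcongr
          · exact a1.trans (by gcongr)
          · linarith
      _ = C1 * t (0 + 1) ^ α := by
          rw [hC1]
          ring
      _ ≤ (C1 + C2) * X := by
          gcongr
          · linarith
          · simpa using h5
  · have htn : 0 < t n := gradedMesh_pos hr hT hK h0
    have hsub : Set.Icc (t n) (t (n + 1)) ⊆ Set.Ioc 0 T := fun s hs =>
      ⟨htn.trans_le hs.1, hs.2.trans hTn⟩
    have hd0 := fun y hy => (h.d0 y (hsub hy)).mono hsub
    have hd1 := fun y hy => (h.d1 y (hsub hy)).mono hsub
    have hM := fun y (hy : y ∈ Set.Icc (t n) (t (n + 1))) =>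
      h.norm_second_le hα1 htn hy.1 (hy.2.trans hTn)
    have hle := (ht (Nat.lt_succ_self n)).le
    have r1 := norm_taylor_one_le (p := t n) (s := x) hd0 hd1 hM
      (Set.uIcc_subset_Icc ⟨le_rfl, hle⟩ ⟨hx1.le, hx2⟩)
    have r2 := norm_taylor_one_le (p := t n) (s := t (n + 1)) hd0 hd1 hM
      (Set.uIcc_subset_Icc ⟨le_rfl, hle⟩ ⟨hle, le_rfl⟩)
    have hxs : x - t n = (1 - α / 2) * step t (n + 1) := by
      rw [hx, node_succ]
      ring
    have hst : t (n + 1) - t n = step t (n + 1) := rfl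
    set R1 := u x - u (t n) - (x - t n) • v1 (t n) with hR1
    set R2 := u (t (n + 1)) - u (t n) - (t (n + 1) - t n) • v1 (t n) with hR2
    have e : u x - ((1 - α / 2) • u (t (n + 1)) + (α / 2) • u (t n)) =
        R1 - (1 - α / 2) • R2 := by
      rw [hR1, hR2, hxs, hst]
      module
    rw [hxs, abs_of_pos (mul_pos hσ hs)] at r1
    rw [hst, abs_of_pos hs] at r2
    have hM0 : 0 ≤ B * t n ^ (α - 2) := by positivity
    have r1' : ‖R1‖ ≤ B * t n ^ (α - 2) * step t (n + 1) ^ 2 := by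
      refine r1.trans ?_
      gcongr
      nlinarith
    have b1 := step_gradedMesh_le (K := K) hr hT (Nat.le_add_left 1 n)
    have b4 := gradedMesh_prev_rpow_le hr hT hK (β := α - 2) (by linarith) h0
    push_cast at b1 h5
    rw [← ht_def] at b1 b4
    have hJ0 : 0 < (n : ℝ) + 1 := by positivity
    have h7 : t (n + 1) ^ (α - 2) * t (n + 1) ^ 2 = t (n + 1) ^ α := by
      rw [← Real.rpow_natCast _ 2, ← Real.rpow_add hy]
      norm_num
    rw [e]
    calc _ ≤ ‖R1‖ + (1 - α / 2) * ‖R2‖ := by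
          refine (_root_.norm_sub_le _ _).trans (le_of_eq ?_)
          rw [norm_smul, Real.norm_eq_abs, abs_of_pos hσ]
      _ ≤ B * t n ^ (α - 2) * step t (n + 1) ^ 2 +
          1 * (B * t n ^ (α - 2) * step t (n + 1) ^ 2) := by
          gcongr
          linarith
      _ = 2 * (B * t n ^ (α - 2) * step t (n + 1) ^ 2) := by ring
      _ ≤ 2 * (B * (((2 : ℝ) ^ r)⁻¹ ^ (α - 2) * t (n + 1) ^ (α - 2)) *
          (max r 1 * t (n + 1) / ((n : ℝ) + 1)) ^ 2) := by gcongr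
      _ = C2 * (t (n + 1) ^ (α - 2) * t (n + 1) ^ 2) / ((n : ℝ) + 1) ^ 2 := by
          rw [hC2]
          field_simp
      _ ≤ C2 * (T ^ α * ((n : ℝ) + 1) ^ 2 / (K : ℝ) ^ min (r * α) 2) / ((n : ℝ) + 1) ^ 2 := by
          rw [h7]
          gcongr
      _ = C2 * X := by
          rw [hX]
          field_simp
      _ ≤ (C1 + C2) * X := by
          gcongr
          linarith

end GlobalTruncation

/-! ### From the regularity hypotheses to `WeaklySingular`. -/

section Regularity

/-- On `(0, T]` the constant `1` equals `s^(m-α) s^(α-m)`, at most `T^(m-α) s^(α-m)`, so the pure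
power suffices. The absolute value covers possibly negative `c`. -/
theorem mul_one_add_rpow_le {α T : ℝ} (hα1 : α < 1) {m : ℝ} (hm : 1 ≤ m) (c : ℝ) {s : ℝ}
    (hs : s ∈ Set.Ioc 0 T) :
    c * (1 + s ^ (α - m)) ≤ |c| * (1 + T ^ (m - α)) * s ^ (α - m) := by
  have h1 : s ^ (m - α) * s ^ (α - m) = 1 := by
    rw [← Real.rpow_add hs.1]
    simp
  have h2 : s ^ (m - α) ≤ T ^ (m - α) := Real.rpow_le_rpow hs.1.le hs.2 (by linarith)
  have h3 : 0 < s ^ (α - m) := Real.rpow_pos_of_pos hs.1 _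
  calc c * (1 + s ^ (α - m)) ≤ |c| * (1 + s ^ (α - m)) := by
        gcongr
        exact le_abs_self c
    _ = |c| * (s ^ (m - α) * s ^ (α - m) + s ^ (α - m)) := by rw [h1]
    _ ≤ |c| * (T ^ (m - α) * s ^ (α - m) + s ^ (α - m)) := by gcongr
    _ = _ := by ring

variable {E : Type*} [NormedAddCommGroup E] [NormedSpace ℝ E]

theorem weaklySingular_of_contDiffOn {α T : ℝ} (hα1 : α < 1) {Cm : ℕ → ℝ} {B : ℝ}
    (hBC : ∀ m ∈ Finset.Icc 1 3, |Cm m| * (1 + T ^ ((m : ℝ) - α)) ≤ B) {u : ℝ → E}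
    (hu : ContDiffOn ℝ 3 u (Set.Ioc 0 T))
    (hC : ∀ m ∈ Finset.Icc 1 3, ∀ t ∈ Set.Ioc 0 T,
        ‖iteratedDerivWithin m u (Set.Ioc 0 T) t‖ ≤ Cm m * (1 + t ^ (α - (m : ℝ))))
    (h0 : Tendsto u (𝓝[>] 0) (𝓝 (u 0))) :
    WeaklySingular α T B u (iteratedDerivWithin 1 u (Set.Ioc 0 T))
      (iteratedDerivWithin 2 u (Set.Ioc 0 T)) (iteratedDerivWithin 3 u (Set.Ioc 0 T)) := by
  have hun : UniqueDiffOn ℝ (Set.Ioc (0 : ℝ) T) := uniqueDiffOn_Ioc 0 T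
  have hd : ∀ m < 3, ∀ s ∈ Set.Ioc 0 T, HasDerivWithinAt (iteratedDerivWithin m u (Set.Ioc 0 T))
      (iteratedDerivWithin (m + 1) u (Set.Ioc 0 T) s) (Set.Ioc 0 T) s := by
    intro m hm s hs
    rw [iteratedDerivWithin_succ]
    exact (hu.differentiableOn_iteratedDerivWithin (by exact_mod_cast hm) hun s hs).hasDerivWithinAt
  have hb : ∀ m ∈ Finset.Icc 1 3, ∀ s ∈ Set.Ioc 0 T,
      ‖iteratedDerivWithin m u (Set.Ioc 0 T) s‖ ≤ B * s ^ (α - (m : ℝ)) := by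
    intro m hm s hs
    have h1 : (1 : ℝ) ≤ m := by exact_mod_cast (Finset.mem_Icc.1 hm).1
    have h3 : 0 < s ^ (α - (m : ℝ)) := Real.rpow_pos_of_pos hs.1 _
    exact ((hC m hm s hs).trans (mul_one_add_rpow_le hα1 h1 _ hs)).trans
      (mul_le_mul_of_nonneg_right (hBC m hm) h3.le)
  refine ⟨?_, ?_, hd 1 (by norm_num), hd 2 (by norm_num), ?_, ?_, ?_⟩
  · intro s hs
    rcases hs.1.eq_or_lt with rfl | h
    -- Continuity at `0` comes from attainment of the initial value, as the differentiability holds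
    -- only on `(0, T]`.
    · have : ContinuousWithinAt u (Set.Ioi 0) 0 := h0
      exact (continuousWithinAt_insert_self.2 this).mono fun y hy => by
        rcases hy.1.eq_or_lt with rfl | h
        · exact Set.mem_insert _ _
        · exact Set.mem_insert_of_mem _ h
    · have h1 := hu.continuousOn s ⟨h, hs.2⟩
      refine h1.mono_of_mem_nhdsWithin ?_
      filter_upwards [self_mem_nhdsWithin, mem_nhdsWithin_of_mem_nhds (Ioi_mem_nhds h)] with y hy hy'
      exact ⟨hy', hy.2⟩
  · have := hd 0 (by norm_num)
    rwa [iteratedDerivWithin_zero] at this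
  · simpa using hb 1 (by simp)
  · simpa using hb 2 (by simp)
  · simpa using hb 3 (by simp)

end Regularity

/-! ### The error equation and its energy estimate. -/

section Error

variable {d : ℕ} {Ω : Set (Space d)}

/-- The linear map underlying `fn`. -/
noncomputable def fnLin (Ω : Set (Space d)) : H01 Ω →ₗ[ℝ] L2 Ω ℝ where
  toFun := fn
  map_add' _ _ := rfl
  map_smul' _ _ := rfl

theorem norm_fn_le (v : H01 Ω) : ‖fn v‖ ≤ ‖v‖ :=
  WithLp.norm_fst_le (x := (v : L2Pair Ω))

theorem norm_weakGrad_le (v : H01 Ω) : ‖weakGrad v‖ ≤ ‖v‖ :=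
  WithLp.norm_snd_le (x := (v : L2Pair Ω))

theorem opL_sub {E : Type*} [NormedAddCommGroup E] [NormedSpace ℝ E] {α : ℝ} (hα1 : α < 1)
    {t : ℕ → ℝ} (ht : StrictMono t) (U V : ℕ → E) (n : ℕ) :
    opL α t (fun k => U k - V k) (n + 1) = opL α t U (n + 1) - opL α t V (n + 1) := by
  rw [opL_eq_sum hα1 ht, opL_eq_sum hα1 ht, opL_eq_sum hα1 ht, ← smul_sub,
    ← Finset.sum_sub_distrib]
  congr 1
  apply Finset.sum_congr rfl
  intro i _
  module

theorem fn_opL {α : ℝ} (hα1 : α < 1) {t : ℕ → ℝ} (ht : StrictMono t) (U : ℕ → H01 Ω) (n : ℕ) :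
    fn (opL α t U (n + 1)) = (Real.Gamma (1 - α))⁻¹ •
      ∑ i ∈ Finset.range (n + 1), diffKernel α t n i • (fn (U (i + 1)) - fn (U i)) := by
  change fnLin Ω (opL α t U (n + 1)) = (Real.Gamma (1 - α))⁻¹ •
      ∑ i ∈ Finset.range (n + 1), diffKernel α t n i • (fnLin Ω (U (i + 1)) - fnLin Ω (U i))
  rw [opL_eq_sum hα1 ht, map_smul, map_sum]
  simp only [map_smul, map_sub]

/-- The error equation tested with the weighted average of two consecutive errors. -/
theorem two_mul_inner_opL_le {α T : ℝ} (hα1 : α < 1) {t : ℕ → ℝ} (ht : StrictMono t)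
    {f : ℝ → H01 Ω →L[ℝ] ℝ} {u₀ : H01 Ω} {u : ℝ → H01 Ω} (hu : IsSolution α T f u₀ u) {K n : ℕ}
    {U : ℕ → H01 Ω} (hU : IsSchemeSolution α t K f u₀ U) (hn : n < K)
    (hx : node α t (n + 1) ∈ Set.Ioc 0 T) (z : H01 Ω)
    (hz : z = (1 - α / 2) • (u (t (n + 1)) - U (n + 1)) + (α / 2) • (u (t n) - U n)) :
    2 * inner ℝ (fn (opL α t (fun k => u (t k) - U k) (n + 1))) (fn z) ≤
      2 * ‖caputo α u (node α t (n + 1)) - opL α t (fun k => u (t k)) (n + 1)‖ * ‖fn z‖ +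
      ‖u (node α t (n + 1)) - ((1 - α / 2) • u (t (n + 1)) + (α / 2) • u (t n))‖ ^ 2 := by
  set R := caputo α u (node α t (n + 1)) - opL α t (fun k => u (t k)) (n + 1) with hR
  set S := u (node α t (n + 1)) - ((1 - α / 2) • u (t (n + 1)) + (α / 2) • u (t n)) with hS
  have e1 := hu.2.2 _ hx z
  have e2 := hU.2 (n + 1) (Finset.mem_Icc.2 ⟨by omega, hn⟩) z
  rw [Nat.add_sub_cancel] at e2
  have f1 : fn (opL α t (fun k => u (t k) - U k) (n + 1)) =
      fn (caputo α u (node α t (n + 1))) - fn R - fn (opL α t U (n + 1)) := by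
    have : opL α t (fun k => u (t k) - U k) (n + 1) =
        caputo α u (node α t (n + 1)) - R - opL α t U (n + 1) := by
      rw [opL_sub hα1 ht, hR]
      abel
    rw [this]
    rfl
  have f2 : weakGrad z = weakGrad (u (node α t (n + 1))) - weakGrad S -
      ((1 - α / 2) • weakGrad (U (n + 1)) + (α / 2) • weakGrad (U n)) := by
    have : z = u (node α t (n + 1)) - S - ((1 - α / 2) • U (n + 1) + (α / 2) • U n) := by
      rw [hz, hS]
      module
    rw [this]
    rfl
  have f3 : inner ℝ (weakGrad z) (weakGrad z) = inner ℝ (weakGrad (u (node α t (n + 1)))) (weakGrad z)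
      - inner ℝ (weakGrad S) (weakGrad z) -
      ((1 - α / 2) * inner ℝ (weakGrad (U (n + 1))) (weakGrad z) +
        α / 2 * inner ℝ (weakGrad (U n)) (weakGrad z)) := by
    have e := congrArg (fun y => inner ℝ y (weakGrad z)) f2
    rwa [inner_sub_left, inner_sub_left, inner_add_left, real_inner_smul_left,
      real_inner_smul_left] at e
  rw [real_inner_self_eq_norm_sq] at f3
  rw [f1, inner_sub_left, inner_sub_left, e1, e2]
  have g1 : -inner ℝ (fn R) (fn z) ≤ ‖R‖ * ‖fn z‖ :=
    (neg_le_abs _).trans ((abs_real_inner_le_norm _ _).trans (by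
      gcongr
      exact norm_fn_le R))
  have g2 : -inner ℝ (weakGrad S) (weakGrad z) ≤ ‖S‖ * ‖weakGrad z‖ :=
    (neg_le_abs _).trans ((abs_real_inner_le_norm _ _).trans (by
      gcongr
      exact norm_weakGrad_le S))
  -- The gradient terms are `2 ‖S‖ ‖∇z‖ - 2 ‖∇z‖² ≤ ‖S‖²`, so no second space derivative of `u` is
  -- needed.
  nlinarith [sq_nonneg (‖S‖ - ‖weakGrad z‖), sq_nonneg ‖weakGrad z‖]

/-- If the conclusion failed, the summand `1` would force `Y < N`, so the right side of `h` would be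
at most `(a + b) Y N < N²`. -/
theorem le_of_sq_le_add {a b Y N : ℝ} (ha : 0 ≤ a) (hb : 0 ≤ b) (hY : 0 < Y)
    (h : N ^ 2 ≤ a * Y * N + b * Y ^ 2) : N ≤ (a + b + 1) * Y := by
  by_contra! hN
  have h1 : Y < N := by nlinarith
  have h2 : 0 < N - (a + b + 1) * Y := by linarith
  have h3 : 0 < N * (N - (a + b + 1) * Y) := mul_pos (hY.trans h1) h2
  have h4 : 0 ≤ b * Y * (N - Y) := by
    have : 0 < N - Y := by linarith
    positivity
  have h5 : 0 < Y * N := mul_pos hY (hY.trans h1)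
  nlinarith

end Error

/-! ### Coercivity of the discrete operator and stability of the scheme. -/

section Error

variable {d : ℕ} {Ω : Set (Space d)}

theorem diffKernel_succ_of_ratio {α : ℝ} (hα0 : 0 < α) (hα1 : α < 1) {t : ℕ → ℝ}
    (ht : StrictMono t) {K : ℕ}
    (hratio : ∀ k, 2 ≤ k → k ≤ K → 1 ≤ 3 * ratio t k ^ 2 * (1 + ratio t k)) {n : ℕ} (hn : n < K) :
    (∀ i < n, diffKernel α t n i ≤ 1 / (node α t (n + 1) - t (i + 1)) ^ α) ∧
    (∀ i < n, diffKernel α t n i ≤ diffKernel α t n (i + 1)) := by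
  have h : ∀ i < n, diffKernel α t n i ≤ 1 / (node α t (n + 1) - t (i + 1)) ^ α := fun i hi =>
    diffKernel_le hα0 hα1 ht hi fun h1 => hratio (i + 1) (by omega) (by omega)
  exact ⟨h, fun i hi => (h i hi).trans (le_diffKernel hα0 hα1 ht hi)⟩

/-- Coercivity of the L2-1σ operator. -/
theorem sum_diffKernel_sq_le {α : ℝ} (hα0 : 0 < α) (hα1 : α < 1) {t : ℕ → ℝ}
    (ht : StrictMono t) {K : ℕ}
    (hratio : ∀ k, 2 ≤ k → k ≤ K → 1 ≤ 3 * ratio t k ^ 2 * (1 + ratio t k)) {n : ℕ} (hn : n < K)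
    (e : ℕ → H01 Ω) :
    ∑ i ∈ Finset.range (n + 1), diffKernel α t n i * (‖fn (e (i + 1))‖ ^ 2 - ‖fn (e i)‖ ^ 2) ≤
      Real.Gamma (1 - α) * (2 * inner ℝ (fn (opL α t e (n + 1)))
        (fn ((1 - α / 2) • e (n + 1) + (α / 2) • e n))) := by
  have hG := Real.Gamma_pos_of_pos (sub_pos.2 hα1)
  obtain ⟨h1, h2⟩ := diffKernel_succ_of_ratio hα0 hα1 ht hratio hn
  -- Here `2σ - 1 = 1 - α`, which cancels the denominator in `le_diffKernel_last`; the intermediate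
  -- quantity is the kernel at `t n`.
  have hlast : ∀ i, i + 1 = n → diffKernel α t n i * (1 - α / 2) ≤
      (2 * (1 - α / 2) - 1) * diffKernel α t n n := by
    rintro i rfl
    have h3 := h1 i (Nat.lt_succ_self i)
    have h4 := le_diffKernel_last hα0 hα1 ht (i + 1)
    have h5 : 0 < 1 - α := by linarith
    rw [div_mul_eq_mul_div, div_le_iff₀ h5] at h4
    have h6 := mul_le_mul_of_nonneg_left h3 (by linarith : 0 ≤ 1 - α / 2)
    linarith
  have hD0 : 0 ≤ diffKernel α t n 0 :=
    (kernel_pos (lt_node hα1 ht (Nat.zero_le n))).le.trans (le_diffKernel hα0 hα1 ht (Nat.zero_le n))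
  have key := sum_mul_sq_sub_le (D := diffKernel α t n) (fun k => fn (e k)) n (σ := 1 - α / 2)
    (by linarith) (by linarith) hD0 h2 hlast
  refine key.trans (le_of_eq ?_)
  rw [fn_opL hα1 ht, real_inner_smul_left, sub_sub_cancel]
  have : fn ((1 - α / 2) • e (n + 1) + (α / 2) • e n) =
    (1 - α / 2) • fn (e (n + 1)) + (α / 2) • fn (e n) := rfl
  rw [this]
  field_simp

/-- Stability: truncation and interpolation errors control the error of the scheme. -/
theorem norm_error_le {α T r : ℝ} (hα0 : 0 < α) (hα1 : α < 1) (hT : 0 < T) (hr : 0 < r) {K : ℕ}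
    (hK : 1 ≤ K)
    (hratio : ∀ k, 2 ≤ k → k ≤ K →
      1 ≤ 3 * ratio (gradedMesh r T K) k ^ 2 * (1 + ratio (gradedMesh r T K) k))
    {f : ℝ → H01 Ω →L[ℝ] ℝ} {u₀ : H01 Ω} {u : ℝ → H01 Ω} (hu : IsSolution α T f u₀ u)
    {U : ℕ → H01 Ω} (hU : IsSchemeSolution α (gradedMesh r T K) K f u₀ U)
    {C1 C2 Y : ℝ} (hC1 : 0 ≤ C1) (hY : 0 < Y)
    (hR : ∀ n < K, gradedMesh r T K (n + 1) ^ α *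
        ‖caputo α u (node α (gradedMesh r T K) (n + 1)) -
          opL α (gradedMesh r T K) (fun k => u (gradedMesh r T K k)) (n + 1)‖ ≤ C1 * Y)
    (hS : ∀ n < K, ‖u (node α (gradedMesh r T K) (n + 1)) -
          ((1 - α / 2) • u (gradedMesh r T K (n + 1)) + (α / 2) • u (gradedMesh r T K n))‖ ≤
        C2 * Y) {k : ℕ} (hk : k ≤ K) :
    ‖fn (u (gradedMesh r T K k)) - fn (U k)‖ ≤
      (Real.Gamma (1 - α) * (2 * C1) + Real.Gamma (1 - α) * (T ^ α * C2 ^ 2) + 1) * Y := by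
  have hG := Real.Gamma_pos_of_pos (sub_pos.2 hα1)
  have ht := gradedMesh_strictMono hr hT hK
  set t := gradedMesh r T K with ht_def
  have ht0 : t 0 = 0 := gradedMesh_zero hr
  set e : ℕ → H01 Ω := fun k => u (t k) - U k with he
  -- The bound `M` below involves the maximal error `N` itself; evaluating the maximum principle at
  -- the maximizing index closes the argument as a quadratic inequality in `N`.
  obtain ⟨k₀, hk₀, hmax⟩ := Finset.exists_max_image (Finset.range (K + 1)) (fun k => ‖fn (e k)‖)
    ⟨0, by simp⟩
  set N := ‖fn (e k₀)‖ with hN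
  have hNmax : ∀ j ≤ K, ‖fn (e j)‖ ≤ N := fun j hj => hmax j (by simp; omega)
  have hN0 : 0 ≤ N := norm_nonneg _
  set M := Real.Gamma (1 - α) * (2 * C1 * Y * N + T ^ α * (C2 * Y) ^ 2) with hM
  have hM0 : 0 ≤ M := by positivity
  have hsum : ∀ n < K, ∑ i ∈ Finset.range (n + 1),
      diffKernel α t n i * (‖fn (e (i + 1))‖ ^ 2 - ‖fn (e i)‖ ^ 2) ≤ diffKernel α t n 0 * M := by
    intro n hn
    have hy := gradedMesh_pos hr hT hK (Nat.le_add_left 1 n)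
    have hyT := gradedMesh_le hr hT hK hn
    rw [← ht_def] at hy hyT
    have hx0 : 0 < node α t (n + 1) := ht0 ▸ lt_node hα1 ht (Nat.zero_le n)
    have hxy := node_le hα0 ht n
    have hfz : ‖fn ((1 - α / 2) • e (n + 1) + (α / 2) • e n)‖ ≤ N := by
      have h1 : fn ((1 - α / 2) • e (n + 1) + (α / 2) • e n) =
        (1 - α / 2) • fn (e (n + 1)) + (α / 2) • fn (e n) := rfl
      have hσ : 0 ≤ 1 - α / 2 := by linarith
      rw [h1]
      refine (norm_add_le _ _).trans ?_
      rw [norm_smul, norm_smul, Real.norm_eq_abs, Real.norm_eq_abs, abs_of_nonneg hσ,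
        abs_of_pos (by linarith : 0 < α / 2)]
      have h2 := mul_le_mul_of_nonneg_left (hNmax (n + 1) hn) hσ
      have h3 := mul_le_mul_of_nonneg_left (hNmax n hn.le) (by linarith : 0 ≤ α / 2)
      linarith
    have h1 := sum_diffKernel_sq_le hα0 hα1 ht hratio hn e
    have h2 := two_mul_inner_opL_le hα1 ht hu hU hn ⟨hx0, hxy.trans hyT⟩ _ rfl
    have h3 := hR n hn
    have h4 := hS n hn
    set ρ := ‖caputo α u (node α t (n + 1)) - opL α t (fun k => u (t k)) (n + 1)‖ with hρ
    set s := ‖u (node α t (n + 1)) - ((1 - α / 2) • u (t (n + 1)) + (α / 2) • u (t n))‖ with hs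
    have hρ0 : 0 ≤ ρ := norm_nonneg _
    have hs0 : 0 ≤ s := norm_nonneg _
    have hyα : 0 < t (n + 1) ^ α := Real.rpow_pos_of_pos hy _
    have hyTα : t (n + 1) ^ α ≤ T ^ α := Real.rpow_le_rpow hy.le hyT hα0.le
    -- This lower bound for the first kernel entry is why the truncation error needs controlling
    -- only after multiplication by `t (n + 1) ^ α`.
    have hD : 1 / t (n + 1) ^ α ≤ diffKernel α t n 0 := by
      refine le_trans ?_ (le_diffKernel hα0 hα1 ht (Nat.zero_le n))
      rw [ht0, sub_zero]
      apply one_div_le_one_div_of_le (Real.rpow_pos_of_pos hx0 _)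
      exact Real.rpow_le_rpow hx0.le hxy hα0.le
    have h5 : t (n + 1) ^ α * (2 * ρ * N + s ^ 2) ≤ 2 * C1 * Y * N + T ^ α * (C2 * Y) ^ 2 := by
      calc _ = 2 * (t (n + 1) ^ α * ρ) * N + t (n + 1) ^ α * s ^ 2 := by ring
        _ ≤ 2 * (C1 * Y) * N + T ^ α * (C2 * Y) ^ 2 := by gcongr
        _ = _ := by ring
    calc _ ≤ Real.Gamma (1 - α) * (2 * ρ * N + s ^ 2) := by
          refine h1.trans ?_
          gcongr
          refine h2.trans ?_
          gcongr
      _ = 1 / t (n + 1) ^ α * (Real.Gamma (1 - α) * (t (n + 1) ^ α * (2 * ρ * N + s ^ 2))) := by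
          field_simp
      _ ≤ 1 / t (n + 1) ^ α * M := by
          rw [hM]
          gcongr
      _ ≤ _ := by gcongr
  have hv := le_of_kernel_sum_le (D := diffKernel α t) (v := fun k => ‖fn (e k)‖ ^ 2) hM0 K
    (fun n _ => (kernel_pos (lt_node hα1 ht le_rfl)).trans_le (le_diffKernel hα0 hα1 ht le_rfl))
    (fun n hn => (diffKernel_succ_of_ratio hα0 hα1 ht hratio hn).2) hsum
    (show k₀ ≤ K by simp at hk₀; omega)
  have he0 : fn (e 0) = 0 := by
    have : e 0 = 0 := by
      simp only [he, ht0, hu.1, hU.1, sub_self]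
    rw [this]
    rfl
  simp only [he0, norm_zero, ne_eq, OfNat.ofNat_ne_zero, not_false_eq_true, zero_pow, zero_add]
    at hv
  have hfin := le_of_sq_le_add (a := Real.Gamma (1 - α) * (2 * C1))
    (b := Real.Gamma (1 - α) * (T ^ α * C2 ^ 2)) (by positivity) (by positivity) hY
    (hv.trans (le_of_eq (by rw [hM]; ring)))
  exact (hNmax k hk).trans hfin

end Error

end Subdiffusion

/-! ### Assembly of consistency and stability. -/

theorem mainTheorem4 {d : ℕ} (Ω : Set (Subdiffusion.Space d)) (hΩ : IsOpen Ω)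
    (α : ℝ) (hα0 : 0 < α) (hα1 : α < 1) (T : ℝ) (hT : 0 < T) (r : ℝ) (hr : 0 < r)
    (η : ℝ) (hη : 0 < η) (hη_root : 1 - 3 * η ^ 2 * (1 + η) = 0)
    (Cm : ℕ → ℝ) :
    ∃ C : ℝ, ∀ (f : ℝ → Subdiffusion.H01 Ω →L[ℝ] ℝ) (u₀ : Subdiffusion.H01 Ω)
      (u : ℝ → Subdiffusion.H01 Ω),
      ContDiffOn ℝ 3 u (Set.Ioc 0 T) →
      (∀ m ∈ Finset.Icc 1 3, ∀ t ∈ Set.Ioc 0 T,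
        ‖iteratedDerivWithin m u (Set.Ioc 0 T) t‖ ≤ Cm m * (1 + t ^ (α - (m : ℝ)))) →
      Subdiffusion.IsSolution α T f u₀ u →
      ∀ K : ℕ, 1 ≤ K →
        (1 ≤ r ∨ ∀ k ∈ Finset.Icc 2 K,
          η ≤ Subdiffusion.ratio (Subdiffusion.gradedMesh r T K) k) →
        ∀ U : ℕ → Subdiffusion.H01 Ω,
          Subdiffusion.IsSchemeSolution α (Subdiffusion.gradedMesh r T K) K f u₀ U →
          ∀ k ∈ Finset.Icc 1 K,
            ‖Subdiffusion.fn (u (Subdiffusion.gradedMesh r T K k)) - Subdiffusion.fn (U k)‖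
              ≤ C / (K : ℝ) ^ min (r * α) 2 := by
  open Subdiffusion in
  -- Summing the nonnegative constants of the three derivatives gives one bound that serves all of
  -- them.
  obtain ⟨B, hB⟩ : ∃ B, B = ∑ m ∈ Finset.Icc 1 3, |Cm m| * (1 + T ^ ((m : ℝ) - α)) := ⟨_, rfl⟩
  have hBm : ∀ m ∈ Finset.Icc 1 3, |Cm m| * (1 + T ^ ((m : ℝ) - α)) ≤ B := fun m hm =>
    hB ▸ Finset.single_le_sum (f := fun m : ℕ => |Cm m| * (1 + T ^ ((m : ℝ) - α)))
      (fun i _ => by positivity) hm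
  have hB0 : 0 ≤ B := hB ▸ Finset.sum_nonneg fun i _ => by positivity
  obtain ⟨C1, hC1, hR⟩ := exists_truncation_bound hα0 hα1 hr hT hB0 (H01 Ω)
  obtain ⟨C2, hC2, hS⟩ := exists_interpolation_bound hα0 hα1 hr hT hB0 (H01 Ω)
  refine ⟨Real.Gamma (1 - α) * (2 * C1) + Real.Gamma (1 - α) * (T ^ α * C2 ^ 2) + 1, ?_⟩
  intro f u₀ u hu3 hbound hsol K hK hmesh U hU k hk
  have hw := weaklySingular_of_contDiffOn hα1 hBm hu3 hbound (by rw [hsol.1]; exact hsol.2.1)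
  have hratio : ∀ k, 2 ≤ k → k ≤ K →
      1 ≤ 3 * ratio (gradedMesh r T K) k ^ 2 * (1 + ratio (gradedMesh r T K) k) := by
    intro k hk2 hkK
    -- Both alternatives enter only through `1 ≤ 3ρ²(1+ρ)`: grading with `r ≥ 1` gives `ρ ≥ 1`, and
    -- `η` is the threshold where equality holds.
    rcases hmesh with h | h
    · have h1 := one_le_ratio_gradedMesh h hT hK hk2
      nlinarith [one_le_pow₀ h1 (n := 2)]
    · exact one_le_of_root_le hη hη_root (h k (Finset.mem_Icc.2 ⟨hk2, hkK⟩))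
  have hY : 0 < 1 / (K : ℝ) ^ min (r * α) 2 := by
    have : (0 : ℝ) < K := by exact_mod_cast hK
    positivity
  have := norm_error_le hα0 hα1 hT hr hK hratio hsol hU hC1 hY
    (hR u _ _ _ hw K hK) (hS u _ _ _ hw K hK) (Finset.mem_Icc.1 hk).2
  rwa [mul_one_div] at this
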